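/- Let $\mathbb D$ be the open unit disc, $dA=\pi^{-1}dx\,dy$, and let $\mathrm{Aut}(\mathbb D)$ be the set of one-to-one analytic maps of $\mathbb D$ onto itself. For a positive Borel measure $\mu$ on $\mathbb D$ put $$U_\mu(z)=\int_{\mathbb D}\log\left|\frac{1-\overline w z}{z-w}\right|^2d\mu(w),\qquad \|f\|_{M(\mathcal D_\mu)}=|f(0)|+\sup_{\phi\in\mathrm{Aut}(\mathbb D)}\left(\int_{\mathbb D}|f'(w)|^2U_\mu(\phi(w))\,dA(w)\right)^{1/2},$$ and let $M(\mathcal D_\mu)$ be the set of analytic $f$ on $\mathbb D$ with $\|f\|_{M(\mathcal D_\mu)}<\infty$. Let $Q_p$ be the set of analytic $f$ on $\mathbb D$ with $$|f(0)|+\sup_{a\in\mathbb D}\left(\int_{\mathbb D}|f'(z)|^2(1-|\sigma_a(z)|^2)^p\,dA(z)\right)^{1/2}<\infty,\qquad \sigma_a(z)=\frac{a-z}{1-\overline a z}.$$ For $f(z)=\sum_k a_kz^k$ in $H^\infty$, the space of bounded analytic functions on $\mathbb D$ with the supremum norm, the Hilbert matrix operator is $$\mathcal H(f)(z)=\sum_{n=0}^\infty\left(\sum_{k=0}^\infty\frac{a_k}{k+n+1}\right)z^n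 .$$ Let $0<p<1$ and $d\mu_p(z)=-\Delta[(1-|z|^2)^p]\,dA(z)$, where $\Delta$ is the Laplacian; this is a positive measure on $\mathbb D$. Then $Q_p=M(\mathcal D_{\mu_p})$, the function $\log(1-z)$ (principal branch) belongs to this space, the series defining $\mathcal H(f)$ converge for all $f\in H^\infty$ and $z\in\mathbb D$, the operator $\mathcal H$ maps $H^\infty$ into $Q_p$, and its norm, when $Q_p$ carries the norm $\|\cdot\|_{M(\mathcal D_{\mu_p})}$, is $$\|\mathcal H\|_{H^\infty\to Q_p}=\sup_{\|f\|_{H^\infty}\le 1}\|\mathcal H(f)\|_{M(\mathcal D_{\mu_p})}=1+\|\log(1-z)\|_{M(\mathcal D_{\mu_p})}.$$ -/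

import Mathlib

open MeasureTheory
open scoped ENNReal

noncomputable section

namespace HilbertQp

/-- The open unit disc. -/
def disc : Set ℂ := Metric.ball 0 1

/-- The normalized area measure `dA = π⁻¹ dx dy` on the unit disc. -/
def areaMeasure : Measure ℂ := (ENNReal.ofReal Real.pi)⁻¹ • volume.restrict disc

/-- `Hol(𝔻)`: analytic functions on the disc (the values outside the disc play no role). -/
def Hol : Set (ℂ → ℂ) := {f | DifferentiableOn ℂ f disc}

/-- The norm `sup_{z ∈ 𝔻} |f z|`, with value `∞` for unbounded functions. -/
def hInfNorm (f : ℂ → ℂ) : ℝ≥0∞ := ⨆ z ∈ disc, ‖f z‖ₑ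

/-- `H^∞`: bounded analytic functions on the disc. -/
def HInf : Set (ℂ → ℂ) := {f | f ∈ Hol ∧ hInfNorm f < ∞}

/-- `Aut(𝔻)`: one-to-one analytic functions mapping the disc onto itself. -/
def discAut : Set (ℂ → ℂ) := {φ | φ ∈ Hol ∧ Set.BijOn φ disc disc}

/-- The Möbius map `σ_a(z) = (a - z) / (1 - conj a * z)`. -/
def mobius (a z : ℂ) : ℂ := (a - z) / (1 - (starRingEnd ℂ) a * z)

/-- The kernel `log |(1 - conj w * z) / (z - w)|²`, equal to `+∞` on the diagonal.
For `z, w` in the disc the logarithm is nonnegative. -/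
def greenKernel (z w : ℂ) : ℝ≥0∞ :=
  if z = w then ∞
  else ENNReal.ofReal (Real.log (‖(1 - (starRingEnd ℂ) w * z) / (z - w)‖ ^ 2))

/-- The potential `U_μ(z) = ∫_𝔻 log |(1 - conj w * z) / (z - w)|² dμ(w)`. -/
def potential (μ : Measure ℂ) (z : ℂ) : ℝ≥0∞ := ∫⁻ w in disc, greenKernel z w ∂μ

/-- `|f(0)| + sup_{φ ∈ Aut(𝔻)} (∫_𝔻 |f'(w)|² U_μ(φ(w)) dA(w))^{1/2}`, with values in `[0, ∞]`. -/
def mNorm (μ : Measure ℂ) (f : ℂ → ℂ) : ℝ≥0∞ :=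
  ‖f 0‖ₑ + ⨆ φ ∈ discAut,
    (∫⁻ w, ‖deriv f w‖ₑ ^ 2 * potential μ (φ w) ∂areaMeasure) ^ (1 / 2 : ℝ)

/-- The Möbius invariant Dirichlet space `M(D_μ)`. -/
def MSpace (μ : Measure ℂ) : Set (ℂ → ℂ) := {f | f ∈ Hol ∧ mNorm μ f < ∞}

/-- `|f(0)| + sup_{a ∈ 𝔻} (∫_𝔻 |f'(z)|² (1 - |σ_a(z)|²)^p dA(z))^{1/2}`, with values in `[0, ∞]`. -/
def qNorm (p : ℝ) (f : ℂ → ℂ) : ℝ≥0∞ :=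
  ‖f 0‖ₑ + ⨆ a ∈ disc,
    (∫⁻ z, ‖deriv f z‖ₑ ^ 2 * ENNReal.ofReal ((1 - ‖mobius a z‖ ^ 2) ^ p) ∂areaMeasure)
      ^ (1 / 2 : ℝ)

/-- The space `Q_p`. -/
def QSpace (p : ℝ) : Set (ℂ → ℂ) := {f | f ∈ Hol ∧ qNorm p f < ∞}

/-- The measure `dμ_p = -Δ[(1 - |z|²)^p] dA` on the disc, `Δ` the Laplacian of `ℂ = ℝ²`.
For `0 < p < 1` the density is nonnegative on the disc. -/
def muP (p : ℝ) : Measure ℂ :=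
  areaMeasure.withDensity fun z =>
    ENNReal.ofReal (-(Laplacian.laplacian (fun w : ℂ => (1 - ‖w‖ ^ 2 : ℝ) ^ p) z))

/-- The `k`-th Taylor coefficient of `f` at `0`. -/
def taylorCoeff (f : ℂ → ℂ) (k : ℕ) : ℂ := iteratedDeriv k f 0 / (k.factorial : ℂ)

/-- The terms `a_k / (k + n + 1)` of the `n`-th entry of the Hilbert matrix applied to the Taylor
coefficients of `f`. -/
def hilbertTerm (f : ℂ → ℂ) (n k : ℕ) : ℂ := taylorCoeff f k / ((k : ℂ) + n + 1)

/-- The coefficient `∑_k a_k / (k + n + 1)`. -/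
def hilbertCoeff (f : ℂ → ℂ) (n : ℕ) : ℂ := ∑' k, hilbertTerm f n k

/-- The Hilbert matrix operator `H(f)(z) = ∑_n (∑_k a_k / (k + n + 1)) z^n`. -/
def hilbertOp (f : ℂ → ℂ) (z : ℂ) : ℂ := ∑' n, hilbertCoeff f n * z ^ n

/-- The operator norm, from `H^∞` with its sup norm to the functions normed by `N`, of a linear
map `T`: the supremum of `N (T f)` over the unit ball of `H^∞`. -/
def opNormHInf (T : (ℂ → ℂ) → ℂ → ℂ) (N : (ℂ → ℂ) → ℝ≥0∞) : ℝ≥0∞ :=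
  ⨆ f ∈ {f | f ∈ HInf ∧ hInfNorm f ≤ 1}, N (T f)

/-- The function `log (1 - z)`, principal branch. -/
def logOneSub (z : ℂ) : ℂ := Complex.log (1 - z)

end HilbertQp

end

namespace HilbertQp

/-! Put u(z) = (1 - |z|²)^p. Since u vanishes on the unit circle, Green's formula gives U = 4u for
the potential of -Δu dA (`potential_muP`). The Schwarz lemma gives |φ| = |σ_a| for every
automorphism φ, with a the zero of φ. So the `MSpace` seminorm is exactly twice the `QSpace` one
(`mSeminorm_muP`).

Upper bound: (H f)'(z) is the integral over [0, 1] of t f(t) / (1 - t z)². Deforming the segment to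
the arc s / (1 - (1 - s) z) turns the integrand into ζ f(ζ) / (1 - z), with ζ on the arc, whence |(H
f)'(z)| ≤ ‖f‖ / |1 - z|, which is ‖f‖ times the modulus of the derivative of log(1 - z). Also |H
f(0)| ≤ ‖f‖.

Lower bound: f = 1 is extremal. Here z H(1)(z) = -log(1 - z), so H(1)(0) = 1. The derivative of H(1)
need not dominate 1 / |1 - z| pointwise, but the seminorm is Möbius invariant: as c → 1 the
derivatives of H(1) ∘ σ_c tend in modulus to 2 / |1 - w²| ≥ 1 / |1 - w|, and Fatou's lemma concludes
(`mSeminorm_logOneSub_le`).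

Finiteness comes from a kernel estimate near the boundary point 1 (`logOneSub_mem_QSpace`),
convergence of the series from H^∞ ⊂ H². -/

theorem mem_disc {z : ℂ} : z ∈ disc ↔ ‖z‖ < 1 := by simp [disc]

theorem one_sub_normSq_pos {z : ℂ} (hz : ‖z‖ < 1) : 0 < 1 - ‖z‖ ^ 2 := by
  nlinarith [norm_nonneg z]

/-! ### The Laplacian of (1 - |z|²)^p -/

theorem hasFDerivAt_one_sub_normSq_rpow (q : ℝ) {z : ℂ} (hz : ‖z‖ < 1) :
    HasFDerivAt (fun w : ℂ => (1 - ‖w‖ ^ 2 : ℝ) ^ q)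
      ((-(2 * q) * (1 - ‖z‖ ^ 2) ^ (q - 1)) • (innerSL ℝ z)) z := by
  have h1 : HasFDerivAt (fun w : ℂ => (1 - ‖w‖ ^ 2 : ℝ)) (-(2 • (innerSL ℝ z))) z :=
    ((hasStrictFDerivAt_norm_sq z).hasFDerivAt).const_sub 1
  have h2 := h1.rpow_const (p := q) (Or.inl (one_sub_normSq_pos hz).ne')
  refine h2.congr_fderiv ?_
  ext v
  simp
  ring

theorem neg_laplacian_one_sub_normSq_rpow (p : ℝ) {z : ℂ} (hz : ‖z‖ < 1) :
    -(Laplacian.laplacian (fun w : ℂ => (1 - ‖w‖ ^ 2 : ℝ) ^ p) z) =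
      4 * p * (1 - ‖z‖ ^ 2) ^ (p - 2) * (1 - p * ‖z‖ ^ 2) := by
  have hpos := one_sub_normSq_pos hz
  -- `innerSL ℝ` is conjugate-linear in its first argument; over ℝ the conjugation is trivial, and
  -- `B` is the same map typed as bilinear.
  obtain ⟨B, hB, hB'⟩ : ∃ B : ℂ →L[ℝ] ℂ →L[ℝ] ℝ, (∀ x, B x = innerSL ℝ x) ∧
      ∀ x y, B x y = x.re * y.re + x.im * y.im :=
    ⟨innerSL ℝ, fun _ => rfl, fun x y => (innerSL_apply_apply ℝ x y).trans
      (by simp [Complex.inner]; ring)⟩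
  have hev : fderiv ℝ (fun w : ℂ => (1 - ‖w‖ ^ 2 : ℝ) ^ p) =ᶠ[nhds z]
      fun w => (-(2 * p) * (1 - ‖w‖ ^ 2) ^ (p - 1)) • B w := by
    have : {w : ℂ | ‖w‖ < 1} ∈ nhds z :=
      (isOpen_lt continuous_norm continuous_const).mem_nhds hz
    filter_upwards [this] with w hw
    rw [hB]
    exact (hasFDerivAt_one_sub_normSq_rpow p hw).fderiv
  have h2 := ((hasFDerivAt_one_sub_normSq_rpow (p - 1) hz).const_mul (-(2 * p))).smul
    (B.hasFDerivAt (x := z))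
  have h3 : fderiv ℝ (fderiv ℝ (fun w : ℂ => (1 - ‖w‖ ^ 2 : ℝ) ^ p)) z = _ :=
    hev.fderiv_eq.trans h2.fderiv
  rw [InnerProductSpace.laplacian_eq_iteratedFDeriv_complexPlane]
  simp only [iteratedFDeriv_two_apply, h3]
  have e1 : (1 - ‖z‖ ^ 2) ^ (p - 1) = (1 - ‖z‖ ^ 2) ^ (p - 2) * (1 - ‖z‖ ^ 2) := by
    rw [← Real.rpow_add_one hpos.ne']; congr 1; ring
  have e2 : ‖z‖ ^ 2 = z.re ^ 2 + z.im ^ 2 := by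
    rw [← Complex.normSq_eq_norm_sq, Complex.normSq_apply]; ring
  have e3 : p - 1 - 1 = p - 2 := by ring
  simp [← hB, hB', e1, e3]
  generalize (1 - ‖z‖ ^ 2) ^ (p - 2) = X
  rw [e2]
  ring

/-! ### The radial integral -/

/-- Nonnegativity of the derivative supplies integrability, so only continuity of `F` is needed at
the endpoints; the radial integrand is unbounded near 1. -/
theorem lintegral_Ioo_deriv_of_nonneg {F F' : ℝ → ℝ} {a b : ℝ} (hab : a ≤ b)
    (hc : ContinuousOn F (Set.Icc a b)) (hd : ∀ x ∈ Set.Ioo a b, HasDerivAt F (F' x) x)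
    (h0 : ∀ x ∈ Set.Ioo a b, 0 ≤ F' x) :
    ∫⁻ x in Set.Ioo a b, ENNReal.ofReal (F' x) = ENNReal.ofReal (F b - F a) := by
  have hi := intervalIntegral.integrableOn_deriv_of_nonneg hc hd h0
  rw [← intervalIntegral.integral_eq_sub_of_hasDerivAt_of_le hab hc hd
    ((intervalIntegrable_iff_integrableOn_Ioc_of_le hab).2 hi),
    intervalIntegral.integral_of_le hab, integral_Ioc_eq_integral_Ioo]
  rw [ofReal_integral_eq_lintegral_ofReal (hi.mono_set Set.Ioo_subset_Ioc_self)]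
  filter_upwards [self_mem_ae_restrict measurableSet_Ioo] with x hx using h0 x hx

/-- `r u'(r)` for `u(r) = (1 - r²)^p`. -/
noncomputable def radialFlux (p r : ℝ) : ℝ := -(2 * p) * r ^ 2 * (1 - r ^ 2) ^ (p - 1)

/-- `r` times the density of `-Δ (1 - |z|²)^p` at `|z| = r`. -/
noncomputable def radialDensity (p r : ℝ) : ℝ := 4 * p * r * (1 - r ^ 2) ^ (p - 2) * (1 - p * r ^ 2)

theorem radialDensity_nonneg {p r : ℝ} (hp0 : 0 < p) (hp1 : p < 1) (h0 : 0 ≤ r) (h1 : r < 1) :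
    0 ≤ radialDensity p r := by
  have : 0 < 1 - r ^ 2 := by nlinarith
  have : 0 ≤ 1 - p * r ^ 2 := by nlinarith
  unfold radialDensity
  positivity

theorem hasDerivAt_one_sub_sq_rpow (q : ℝ) {r : ℝ} (h0 : 0 ≤ r) (h1 : r < 1) :
    HasDerivAt (fun r : ℝ => (1 - r ^ 2) ^ q) (-(2 * q) * r * (1 - r ^ 2) ^ (q - 1)) r := by
  have hpos : 0 < 1 - r ^ 2 := by nlinarith
  have h := ((hasDerivAt_pow 2 r).const_sub 1).rpow_const (p := q) (Or.inl hpos.ne')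
  refine h.congr_deriv ?_
  push_cast
  ring

theorem hasDerivAt_radialFlux (p : ℝ) {r : ℝ} (h0 : 0 ≤ r) (h1 : r < 1) :
    HasDerivAt (radialFlux p) (-radialDensity p r) r := by
  have hpos : 0 < 1 - r ^ 2 := by nlinarith
  have h := ((hasDerivAt_pow 2 r).const_mul (-(2 * p))).mul
    (hasDerivAt_one_sub_sq_rpow (p - 1) h0 h1)
  have e1 : (1 - r ^ 2) ^ (p - 1) = (1 - r ^ 2) ^ (p - 2) * (1 - r ^ 2) := by
    rw [← Real.rpow_add_one hpos.ne']; congr 1; ring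
  have e3 : p - 1 - 1 = p - 2 := by ring
  refine h.congr_deriv ?_
  rw [e3, e1, radialDensity]
  simp
  ring

/-- An antiderivative of `r u'' + u'` times `log r`. -/
noncomputable def radialPrimitive (p r : ℝ) : ℝ := radialFlux p r * Real.log r - (1 - r ^ 2) ^ p

/-- With u(r) = (1 - r²)^p the flux is r u', so flux · (1 / r) cancels the derivative of u and only
flux' · log r survives. -/
theorem hasDerivAt_radialPrimitive (p : ℝ) {r : ℝ} (h0 : 0 < r) (h1 : r < 1) :
    HasDerivAt (radialPrimitive p) (radialDensity p r * -Real.log r) r := by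
  have h := ((hasDerivAt_radialFlux p h0.le h1).mul (Real.hasDerivAt_log h0.ne')).sub
    (hasDerivAt_one_sub_sq_rpow p h0.le h1)
  refine h.congr_deriv ?_
  rw [radialFlux]
  field_simp
  ring

theorem radialPrimitive_one {p : ℝ} (hp0 : 0 < p) : radialPrimitive p 1 = 0 := by
  simp [radialPrimitive, Real.zero_rpow hp0.ne']

theorem continuousOn_radialPrimitive {p : ℝ} (hp0 : 0 < p) :
    ContinuousOn (radialPrimitive p) (Set.Icc 0 1) := by
  have hu : Continuous fun r : ℝ => (1 - r ^ 2) ^ p :=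
    (by fun_prop : Continuous fun r : ℝ => 1 - r ^ 2).rpow_const fun _ => Or.inr hp0.le
  intro r hr
  rcases hr.2.lt_or_eq with h1 | rfl
  · have hpos : 0 < 1 - r ^ 2 := by nlinarith [hr.1]
    refine ContinuousAt.continuousWithinAt ?_
    -- Grouping r² log r as r · (r log r) gives continuity at r = 0 as well.
    have : radialPrimitive p = fun r => -(2 * p) * (1 - r ^ 2) ^ (p - 1) * r * (r * Real.log r)
        - (1 - r ^ 2) ^ p := by
      funext r; simp only [radialPrimitive, radialFlux]; ring
    rw [this]
    refine ContinuousAt.sub (ContinuousAt.mul (ContinuousAt.mul (continuousAt_const.mul ?_)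
      continuousAt_id) Real.continuous_mul_log.continuousAt) hu.continuousAt
    exact (by fun_prop : ContinuousAt (fun r : ℝ => 1 - r ^ 2) r).rpow_const (Or.inl hpos.ne')
  -- At r = 1 the flux may blow up like (1 - r²)^(p - 1); the bounds |log r| ≤ (1 - r) / r and r (1
  -- - r) ≤ 1 - r² leave 2p (1 - r²)^p, which tends to 0.
  · refine ContinuousWithinAt.sub ?_ hu.continuousWithinAt
    have hz : radialFlux p 1 * Real.log 1 = 0 := by simp
    rw [ContinuousWithinAt, hz]
    have hlim : Filter.Tendsto (fun r : ℝ => 2 * p * (1 - r ^ 2) ^ p)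
        (nhdsWithin 1 (Set.Icc 0 1)) (nhds 0) := by
      have : Continuous fun r : ℝ => 2 * p * (1 - r ^ 2) ^ p := by fun_prop
      have h := this.continuousWithinAt (s := Set.Icc 0 1) (x := 1)
      simpa [ContinuousWithinAt, Real.zero_rpow hp0.ne'] using h
    refine squeeze_zero_norm' ?_ hlim
    filter_upwards [self_mem_nhdsWithin] with r hr
    rcases hr.1.eq_or_lt with rfl | h0
    · simp; positivity
    rcases hr.2.lt_or_eq with h1 | rfl
    · have hpos : 0 < 1 - r ^ 2 := by nlinarith
      have hlog : |Real.log r| ≤ (1 - r) / r := by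
        rw [abs_of_nonpos (Real.log_nonpos h0.le h1.le)]
        have := Real.one_sub_inv_le_log_of_pos h0
        have e : (1 - r) / r = r⁻¹ - 1 := by field_simp
        rw [e]; linarith
      have e1 : (1 - r ^ 2) ^ p = (1 - r ^ 2) ^ (p - 1) * (1 - r ^ 2) := by
        rw [← Real.rpow_add_one hpos.ne']; congr 1; ring
      have hX : 0 < (1 - r ^ 2) ^ (p - 1) := by positivity
      rw [radialFlux, Real.norm_eq_abs, abs_mul, abs_mul, abs_mul, abs_neg, abs_of_pos hX,
        abs_of_pos (by positivity : 0 < 2 * p), abs_of_pos (by positivity : 0 < r ^ 2), e1]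
      calc 2 * p * r ^ 2 * (1 - r ^ 2) ^ (p - 1) * |Real.log r|
          ≤ 2 * p * r ^ 2 * (1 - r ^ 2) ^ (p - 1) * ((1 - r) / r) := by gcongr
        _ = 2 * p * (1 - r ^ 2) ^ (p - 1) * (r * (1 - r)) := by field_simp
        _ ≤ 2 * p * (1 - r ^ 2) ^ (p - 1) * (1 - r ^ 2) := by
            gcongr; nlinarith
        _ = _ := by ring
    · simp [Real.zero_rpow hp0.ne']

/-- Integration by parts, split at s. On (s, 1) the weight is -log r and the integral is u(s) -
flux(s) log s; on (0, s) the weight is the constant -log s and the integral is flux(s) log s. The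
flux terms cancel. -/
theorem lintegral_radialDensity_mul_log_max {p s : ℝ} (hp0 : 0 < p) (hp1 : p < 1)
    (h0 : 0 ≤ s) (h1 : s < 1) :
    ∫⁻ r in Set.Ioo (0 : ℝ) 1, ENNReal.ofReal (radialDensity p r * -Real.log (max s r)) =
      ENNReal.ofReal ((1 - s ^ 2) ^ p) := by
  have hpos : 0 < 1 - s ^ 2 := by nlinarith
  have hright : ∫⁻ r in Set.Ioo s 1, ENNReal.ofReal (radialDensity p r * -Real.log (max s r)) =
      ENNReal.ofReal (0 - radialPrimitive p s) := by
    rw [← radialPrimitive_one hp0]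
    refine (setLIntegral_congr_fun measurableSet_Ioo fun r hr => ?_).trans
      (lintegral_Ioo_deriv_of_nonneg (F := radialPrimitive p) h1.le
      ((continuousOn_radialPrimitive hp0).mono (Set.Icc_subset_Icc_left h0))
      (fun r hr => hasDerivAt_radialPrimitive p (h0.trans_lt hr.1) hr.2) fun r hr => ?_)
    · simp only [max_eq_right hr.1.le]
    · exact mul_nonneg (radialDensity_nonneg hp0 hp1 (h0.trans hr.1.le) hr.2)
        (neg_nonneg.2 (Real.log_nonpos (h0.trans hr.1.le) hr.2.le))
  rcases h0.eq_or_lt with rfl | hs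
  · rw [hright]; simp [radialPrimitive, radialFlux]
  have hlog : Real.log s ≤ 0 := Real.log_nonpos h0 h1.le
  have hleft : ∫⁻ r in Set.Ioo 0 s, ENNReal.ofReal (radialDensity p r * -Real.log (max s r)) =
      ENNReal.ofReal (radialFlux p s * Real.log s) := by
    have e : radialFlux p s * Real.log s =
        (fun r => radialFlux p r * Real.log s) s - (fun r => radialFlux p r * Real.log s) 0 := by
      simp [radialFlux]
    rw [e]
    have hd : ∀ r, 0 ≤ r → r < 1 → HasDerivAt (fun r => radialFlux p r * Real.log s)
        (radialDensity p r * -Real.log s) r := fun r hr0 hr1 => by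
      refine ((hasDerivAt_radialFlux p hr0 hr1).mul_const (Real.log s)).congr_deriv ?_
      ring
    refine (setLIntegral_congr_fun measurableSet_Ioo fun r hr => ?_).trans
      (lintegral_Ioo_deriv_of_nonneg (F := fun r => radialFlux p r * Real.log s) h0
      (fun r hr => (hd r hr.1 (hr.2.trans_lt h1)).continuousAt.continuousWithinAt)
      (fun r hr => hd r hr.1.le (hr.2.trans h1)) fun r hr => ?_)
    · simp only [max_eq_left hr.2.le]
    · exact mul_nonneg (radialDensity_nonneg hp0 hp1 hr.1.le (hr.2.trans h1)) (neg_nonneg.2 hlog)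
  have hflux : 0 ≤ radialFlux p s * Real.log s := by
    refine mul_nonneg_of_nonpos_of_nonpos ?_ hlog
    have : 0 ≤ (2 * p) * s ^ 2 * (1 - s ^ 2) ^ (p - 1) := by positivity
    rw [radialFlux]; linarith
  have hsplit : (Set.Ioo (0 : ℝ) 1 : Set ℝ) =ᵐ[volume] (Set.Ioo 0 s ∪ Set.Ioo s 1 : Set ℝ) := by
    have : (Set.Ioo (0 : ℝ) 1) = Set.Ioo 0 s ∪ Set.Ico s 1 := (Set.Ioo_union_Ico_eq_Ioo hs h1.le).symm
    rw [this]
    exact (ae_eq_refl _).union Ioo_ae_eq_Ico.symm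
  rw [setLIntegral_congr hsplit, lintegral_union measurableSet_Ioo, hleft, hright,
    ← ENNReal.ofReal_add hflux]
  · congr 1; rw [radialPrimitive]; ring
  · have : radialPrimitive p s ≤ 0 - 0 := by
      have hmono : radialPrimitive p s ≤ radialPrimitive p 1 := by
        refine monotoneOn_of_deriv_nonneg (convex_Icc s 1)
          ((continuousOn_radialPrimitive hp0).mono (Set.Icc_subset_Icc_left h0))
          ?_ ?_ (Set.left_mem_Icc.2 h1.le) (Set.right_mem_Icc.2 h1.le) h1.le
        · rw [interior_Icc]
          exact fun r hr => (hasDerivAt_radialPrimitive p (h0.trans_lt hr.1)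
            hr.2).differentiableAt.differentiableWithinAt
        · rw [interior_Icc]
          intro r hr
          rw [(hasDerivAt_radialPrimitive p (h0.trans_lt hr.1) hr.2).deriv]
          exact mul_nonneg (radialDensity_nonneg hp0 hp1 (h0.trans hr.1.le) hr.2)
            (neg_nonneg.2 (Real.log_nonpos (h0.trans hr.1.le) hr.2.le))
      rw [radialPrimitive_one hp0] at hmono
      linarith
    linarith
  · exact Set.disjoint_left.2 fun r hr hr' => lt_asymm hr.2 hr'.1

/-! ### Circle averages of the Green kernel and the potential -/

theorem lintegral_eq_lintegral_polar {f : ℂ → ℝ≥0∞} (hf : Measurable f) :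
    ∫⁻ w, f w = ∫⁻ r in Set.Ioi (0 : ℝ), ENNReal.ofReal r *
      ∫⁻ θ in Set.Ioo (-Real.pi) Real.pi, f (circleMap 0 r θ) := by
  have hm : Measurable fun q : ℝ × ℝ => f (circleMap 0 q.1 q.2) := by
    refine hf.comp ?_
    unfold circleMap
    fun_prop
  rw [← Complex.lintegral_comp_polarCoord_symm, polarCoord_target, Measure.volume_eq_prod,
    setLIntegral_prod]
  · refine setLIntegral_congr_fun measurableSet_Ioi fun r _ => ?_
    rw [← lintegral_const_mul' _ _ ENNReal.ofReal_ne_top]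
    refine lintegral_congr fun θ => ?_
    simp [Complex.polarCoord_symm_apply, circleMap, Complex.exp_mul_I]
  · have : Measurable fun q : ℝ × ℝ => ENNReal.ofReal q.1 * f (circleMap 0 q.1 q.2) := by fun_prop
    simpa [Complex.polarCoord_symm_apply, circleMap, Complex.exp_mul_I] using this.aemeasurable

/-- Polar coordinates run over (-π, π), circle averages over [0, 2π]; periodicity reconciles them.
-/
theorem lintegral_circleMap_ofReal {h : ℂ → ℝ} {r : ℝ} (hi : CircleIntegrable h 0 r)
    (h0 : ∀ θ, 0 ≤ h (circleMap 0 r θ)) :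
    ∫⁻ θ in Set.Ioo (-Real.pi) Real.pi, ENNReal.ofReal (h (circleMap 0 r θ)) =
      ENNReal.ofReal (2 * Real.pi * Real.circleAverage h 0 r) := by
  have hper : Function.Periodic (fun θ => h (circleMap 0 r θ)) (2 * Real.pi) := fun θ => by
    simp only [periodic_circleMap 0 r θ]
  have hle : -Real.pi ≤ Real.pi := by linarith [Real.pi_pos]
  have hint : IntegrableOn (fun θ => h (circleMap 0 r θ)) (Set.Ioo (-Real.pi) Real.pi) := by
    have h1 := hper.intervalIntegrable (t := 0) Real.two_pi_pos.ne' (by rw [zero_add]; exact hi)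
      (-Real.pi) Real.pi
    exact ((intervalIntegrable_iff_integrableOn_Ioc_of_le hle).1 h1).mono_set
      Set.Ioo_subset_Ioc_self
  rw [← ofReal_integral_eq_lintegral_ofReal hint (Filter.Eventually.of_forall h0),
    ← integral_Ioc_eq_integral_Ioo, ← intervalIntegral.integral_of_le hle, Real.circleAverage]
  have := hper.intervalIntegral_add_eq (-Real.pi) 0
  rw [show -Real.pi + 2 * Real.pi = Real.pi by ring, zero_add] at this
  rw [this, smul_eq_mul]
  congr 1
  field_simp

theorem one_sub_conj_mul_ne_zero {a z : ℂ} (ha : ‖a‖ ≤ 1) (hz : ‖z‖ < 1) :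
    1 - (starRingEnd ℂ) a * z ≠ 0 := by
  intro h
  have h1 : (starRingEnd ℂ) a * z = 1 := (sub_eq_zero.1 h).symm
  have h2 := congrArg norm h1
  rw [norm_mul, RCLike.norm_conj, norm_one] at h2
  nlinarith [norm_nonneg a, norm_nonneg z]

theorem norm_one_sub_conj_mul_comm (a z : ℂ) :
    ‖1 - (starRingEnd ℂ) a * z‖ = ‖1 - (starRingEnd ℂ) z * a‖ := by
  rw [← RCLike.norm_conj]
  simp [mul_comm]

/-- Source of both the positivity of the Green kernel and the formula for 1 - |σ_a|². -/
theorem normSq_one_sub_conj_mul_sub (a z : ℂ) :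
    ‖1 - (starRingEnd ℂ) a * z‖ ^ 2 - ‖a - z‖ ^ 2 = (1 - ‖a‖ ^ 2) * (1 - ‖z‖ ^ 2) := by
  simp only [← Complex.normSq_eq_norm_sq, Complex.normSq_apply]
  simp
  ring

/-- Jensen's formula: log|1 - conj z · w| is harmonic in w on |w| ≤ r with mean log 1 = 0, and log|w
- z| has mean log max(|z|, r). The radius r = |z|, where the circle meets the pole, is a null set in
the later integration. -/
theorem lintegral_greenKernel_circleMap {z : ℂ} (hz : ‖z‖ < 1) {r : ℝ} (h0 : 0 < r) (h1 : r < 1)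
    (hne : r ≠ ‖z‖) :
    ∫⁻ θ in Set.Ioo (-Real.pi) Real.pi, greenKernel z (circleMap 0 r θ) =
      ENNReal.ofReal (4 * Real.pi * -Real.log (max ‖z‖ r)) := by
  have hnorm : ∀ θ, ‖circleMap 0 r θ‖ = r := fun θ => by simp [abs_of_pos h0]
  have hzne : ∀ θ, z ≠ circleMap 0 r θ := fun θ h => hne (by rw [h, hnorm])
  let h : ℂ → ℝ := (2 : ℝ) • ((fun w => Real.log ‖1 - (starRingEnd ℂ) z * w‖) -
    fun w => Real.log ‖w - z‖)
  -- The numerator 1 - conj w · z is antianalytic in w; its modulus equals that of 1 - conj z · w,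
  -- which is analytic in w.
  have hk : ∀ θ, Real.log (‖(1 - (starRingEnd ℂ) (circleMap 0 r θ) * z) /
      (z - circleMap 0 r θ)‖ ^ 2) = h (circleMap 0 r θ) := fun θ => by
    have hw := hnorm θ
    have hne' := hzne θ
    generalize circleMap 0 r θ = w at *
    have hn1 : ‖1 - (starRingEnd ℂ) z * w‖ ≠ 0 :=
      norm_ne_zero_iff.2 (one_sub_conj_mul_ne_zero hz.le (hw ▸ h1))
    have hn2 : ‖w - z‖ ≠ 0 := norm_ne_zero_iff.2 (sub_ne_zero.2 hne'.symm)
    rw [norm_div, Real.log_pow, norm_one_sub_conj_mul_comm w z, norm_sub_rev z w,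
      Real.log_div hn1 hn2]
    simp [h]
  have hA : CircleIntegrable (fun w => Real.log ‖1 - (starRingEnd ℂ) z * w‖) 0 r :=
    MeromorphicOn.circleIntegrable_log_norm (fun w _ => by fun_prop)
  have hB : CircleIntegrable (fun w => Real.log ‖w - z‖) 0 r :=
    circleIntegrable_log_norm_sub_const r
  have hi : CircleIntegrable h 0 r := (hA.sub hB).const_smul
  have hav : Real.circleAverage h 0 r = 2 * -Real.log (max ‖z‖ r) := by
    have eA : Real.circleAverage (fun w => Real.log ‖1 - (starRingEnd ℂ) z * w‖) 0 r = 0 := by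
      rw [AnalyticOnNhd.circleAverage_log_norm_of_ne_zero
        (g := fun w => 1 - (starRingEnd ℂ) z * w) (fun w _ => by fun_prop)]
      · simp
      · intro u hu
        rw [mem_closedBall_zero_iff, abs_of_pos h0] at hu
        exact one_sub_conj_mul_ne_zero hz.le (hu.trans_lt h1)
    have eB : Real.circleAverage (fun w => Real.log ‖w - z‖) 0 r = Real.log (max ‖z‖ r) := by
      rw [circleAverage_log_norm_sub_const_eq_log_radius_add_posLog h0.ne', zero_sub, norm_neg]
      rcases le_total ‖z‖ r with hle | hle
      · rw [max_eq_right hle, Real.posLog_eq_zero_iff _ |>.2, add_zero]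
        rw [abs_of_nonneg (by positivity), inv_mul_le_one₀ h0]
        exact hle
      · have hzpos := h0.trans_le hle
        rw [max_eq_left hle, Real.posLog_eq_log, Real.log_mul (by positivity) hzpos.ne',
          Real.log_inv]
        · ring
        · rw [abs_of_nonneg (by positivity), le_inv_mul_iff₀ h0]
          simpa using hle
    rw [Real.circleAverage_smul, Real.circleAverage_sub hA hB, eA, eB]
    simp
  have hnn : ∀ θ, 0 ≤ h (circleMap 0 r θ) := fun θ => by
    rw [← hk]
    refine Real.log_nonneg ?_
    have hw := hnorm θ
    have hne' := hzne θ
    generalize circleMap 0 r θ = w at *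
    have hn2 : 0 < ‖z - w‖ := norm_pos_iff.2 (sub_ne_zero.2 hne')
    have := normSq_one_sub_conj_mul_sub w z
    have h3 := mul_pos (one_sub_normSq_pos (hw ▸ h1 : ‖w‖ < 1)) (one_sub_normSq_pos hz)
    rw [norm_div, div_pow, one_le_div (by positivity), norm_sub_rev z w]
    linarith
  calc _ = ∫⁻ θ in Set.Ioo (-Real.pi) Real.pi, ENNReal.ofReal (h (circleMap 0 r θ)) := by
        refine lintegral_congr fun θ => ?_
        rw [greenKernel, if_neg (hzne θ), hk]
    _ = _ := by
        rw [lintegral_circleMap_ofReal hi hnn, hav]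
        congr 1; ring

theorem measurable_greenKernel : Measurable fun q : ℂ × ℂ => greenKernel q.1 q.2 := by
  unfold greenKernel
  refine Measurable.ite (measurableSet_eq_fun measurable_fst measurable_snd) measurable_const ?_
  fun_prop

theorem measurableSet_disc : MeasurableSet disc := measurableSet_ball

theorem areaMeasure_ae_mem_disc : ∀ᵐ z ∂areaMeasure, z ∈ disc :=
  Measure.ae_smul_measure (ae_restrict_mem measurableSet_disc) _

/-- The density of `muP p` with respect to the area measure. -/
noncomputable def densityP (p : ℝ) (z : ℂ) : ℝ≥0∞ :=
  ENNReal.ofReal (4 * p * (1 - ‖z‖ ^ 2) ^ (p - 2) * (1 - p * ‖z‖ ^ 2))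

theorem measurable_densityP (p : ℝ) : Measurable (densityP p) := by
  unfold densityP
  fun_prop

theorem muP_eq (p : ℝ) : muP p = areaMeasure.withDensity (densityP p) := by
  refine withDensity_congr_ae ?_
  filter_upwards [areaMeasure_ae_mem_disc] with z hz
  rw [neg_laplacian_one_sub_normSq_rpow p (mem_disc.1 hz), densityP]

theorem areaMeasure_restrict_disc : areaMeasure.restrict disc = areaMeasure := by
  rw [areaMeasure, Measure.restrict_smul, Measure.restrict_restrict measurableSet_disc,
    Set.inter_self]

/-- Both the density and the circle averages of the kernel are radial, so the area integral
collapses to the one-dimensional one. The factor 4 is 4π from the circle averages of the squared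
kernel over the normalization π. -/
theorem potential_muP {p : ℝ} (hp0 : 0 < p) (hp1 : p < 1) {z : ℂ} (hz : ‖z‖ < 1) :
    potential (muP p) z = ENNReal.ofReal (4 * (1 - ‖z‖ ^ 2) ^ p) := by
  have hg : Measurable (greenKernel z) := measurable_greenKernel.comp measurable_prodMk_left
  have hm : Measurable (disc.indicator (densityP p * greenKernel z)) :=
    ((measurable_densityP p).mul hg).indicator measurableSet_disc
  have h1 : potential (muP p) z = (ENNReal.ofReal Real.pi)⁻¹ *
      ∫⁻ w, disc.indicator (densityP p * greenKernel z) w := by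
    rw [potential, muP_eq, restrict_withDensity measurableSet_disc, areaMeasure_restrict_disc,
      lintegral_withDensity_eq_lintegral_mul _ (measurable_densityP p) hg, areaMeasure,
      lintegral_smul_measure, lintegral_indicator measurableSet_disc, smul_eq_mul]
  have hae : ∀ᵐ r : ℝ, r ≠ ‖z‖ := by
    simp [ae_iff]
  have h2 : ∫⁻ w, disc.indicator (densityP p * greenKernel z) w =
      ENNReal.ofReal (4 * Real.pi) * ∫⁻ r in Set.Ioo (0 : ℝ) 1,
        ENNReal.ofReal (radialDensity p r * -Real.log (max ‖z‖ r)) := by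
    rw [lintegral_eq_lintegral_polar hm, ← lintegral_const_mul' _ _ ENNReal.ofReal_ne_top,
      ← lintegral_indicator measurableSet_Ioi, ← lintegral_indicator measurableSet_Ioo]
    refine lintegral_congr_ae ?_
    filter_upwards [hae] with r hr
    by_cases h0 : 0 < r
    swap
    · simp [h0]
    have hnorm : ∀ θ, ‖circleMap 0 r θ‖ = r := fun θ => by simp [abs_of_pos h0]
    rw [Set.indicator_of_mem (Set.mem_Ioi.2 h0)]
    by_cases h1 : r < 1
    swap
    · rw [Set.indicator_of_notMem (fun h => h1 h.2)]
      have : ∀ θ, disc.indicator (densityP p * greenKernel z) (circleMap 0 r θ) = 0 := fun θ =>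
        Set.indicator_of_notMem (fun h => h1 (by rw [mem_disc, hnorm] at h; exact h)) _
      simp [this]
    rw [Set.indicator_of_mem (Set.mem_Ioo.2 ⟨h0, h1⟩)]
    have e : ∀ θ, disc.indicator (densityP p * greenKernel z) (circleMap 0 r θ) =
        ENNReal.ofReal (4 * p * (1 - r ^ 2) ^ (p - 2) * (1 - p * r ^ 2)) *
          greenKernel z (circleMap 0 r θ) := fun θ => by
      rw [Set.indicator_of_mem (by rw [mem_disc, hnorm]; exact h1), Pi.mul_apply, densityP, hnorm]
    simp only [e]
    have hlog : 0 ≤ -Real.log (max ‖z‖ r) :=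
      neg_nonneg.2 (Real.log_nonpos (le_max_of_le_right h0.le) (max_le hz.le h1.le))
    rw [lintegral_const_mul' _ _ ENNReal.ofReal_ne_top,
      lintegral_greenKernel_circleMap hz h0 h1 hr, ← mul_assoc, ← ENNReal.ofReal_mul h0.le,
      ← ENNReal.ofReal_mul' (by have := Real.pi_pos; positivity),
      ← ENNReal.ofReal_mul (by have := Real.pi_pos; positivity)]
    congr 1
    rw [radialDensity]
    ring
  rw [h1, h2, lintegral_radialDensity_mul_log_max hp0 hp1 (norm_nonneg z) hz,
    ENNReal.ofReal_mul (by norm_num), ENNReal.ofReal_mul (by norm_num), mul_comm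
    (ENNReal.ofReal 4) (ENNReal.ofReal Real.pi), mul_assoc, ← mul_assoc,
    ENNReal.inv_mul_cancel (by simpa using Real.pi_pos) ENNReal.ofReal_ne_top, one_mul]

/-! ### Automorphisms of the disc -/

theorem isOpen_disc : IsOpen disc := Metric.isOpen_ball

/-- The inverse is continuous by the open mapping theorem and differentiable wherever φ' ≠ 0 at the
preimage. Zeros of φ' are isolated, so any remaining singularity is removable by continuity. -/
theorem exists_inverse_of_mem_discAut {φ : ℂ → ℂ} (hφ : φ ∈ discAut) :
    ∃ ψ ∈ discAut, ∀ z ∈ disc, ψ (φ z) = z ∧ φ (ψ z) = z := by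
  obtain ⟨hd, hb⟩ := hφ
  have hd' : DifferentiableOn ℂ φ disc := hd
  have han : AnalyticOnNhd ℂ φ disc := hd'.analyticOnNhd isOpen_disc
  let ψ := Function.invFunOn φ disc
  have hinv : Set.InvOn ψ φ disc disc := hb.invOn_invFunOn
  have hbψ : Set.BijOn ψ disc disc :=
    hinv.symm.bijOn hb.surjOn.mapsTo_invFunOn hb.mapsTo
  have hopen : ∀ s ⊆ disc, IsOpen s → IsOpen (φ '' s) := by
    refine (han.is_constant_or_isOpen (convex_ball 0 1).isPreconnected).resolve_left ?_
    rintro ⟨w, hw⟩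
    have h0 : (0 : ℂ) ∈ disc := by simp [mem_disc]
    have h1 : (1 / 2 : ℂ) ∈ disc := by simp [mem_disc]; norm_num
    have := hb.injOn h0 h1 ((hw 0 h0).trans (hw _ h1).symm)
    norm_num at this
  have hcont : ∀ w ∈ disc, ContinuousAt ψ w := by
    intro w hw V hV
    obtain ⟨U, hUV, hU, hwU⟩ := mem_nhds_iff.1 hV
    have hmem : φ '' (U ∩ disc) ∈ nhds w :=
      (hopen _ Set.inter_subset_right (hU.inter isOpen_disc)).mem_nhds
        ⟨ψ w, ⟨hwU, hbψ.mapsTo hw⟩, hinv.2 hw⟩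
    refine Filter.mem_map.2 (Filter.mem_of_superset hmem ?_)
    rintro _ ⟨z, hz, rfl⟩
    rw [Set.mem_preimage, hinv.1 hz.2]
    exact hUV hz.1
  refine ⟨ψ, ⟨fun w hw => ?_, hbψ⟩, fun z hz => ⟨hinv.1 hz, hinv.2 hz⟩⟩
  have hz0 := hbψ.mapsTo hw
  -- Otherwise φ' vanishes on a ball and φ is constant there, against injectivity.
  have hne : ∀ᶠ z in nhdsWithin (ψ w) {ψ w}ᶜ, deriv φ z ≠ 0 := by
    refine (han.deriv (ψ w) hz0).eventually_eq_zero_or_eventually_ne_zero.resolve_left fun h => ?_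
    obtain ⟨ε, hε, hball⟩ := Metric.eventually_nhds_iff_ball.1
      (h.and (isOpen_disc.mem_nhds hz0))
    have hε' : ψ w + (ε / 2 : ℝ) ∈ Metric.ball (ψ w) ε := by
      rw [mem_ball_iff_norm, add_sub_cancel_left, Complex.norm_real, Real.norm_eq_abs,
        abs_of_pos (by linarith)]
      linarith
    have heq : φ (ψ w + (ε / 2 : ℝ)) = φ (ψ w) :=
      Metric.isOpen_ball.is_const_of_deriv_eq_zero (convex_ball (ψ w) ε).isPreconnected
        (hd'.mono fun z hz => (hball z hz).2) (fun z hz => (hball z hz).1) hε'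
        (Metric.mem_ball_self hε)
    have := hb.injOn (hball _ hε').2 hz0 heq
    simp [hε.ne'] at this
  have htends : Filter.Tendsto ψ (nhdsWithin w {w}ᶜ) (nhdsWithin (ψ w) {ψ w}ᶜ) := by
    refine tendsto_nhdsWithin_iff.2 ⟨(hcont w hw).mono_left nhdsWithin_le_nhds, ?_⟩
    filter_upwards [self_mem_nhdsWithin, mem_nhdsWithin_of_mem_nhds (isOpen_disc.mem_nhds hw)]
      with v hv hvd heq
    exact hv (hbψ.injOn hvd hw heq)
  refine (Complex.analyticAt_of_differentiable_on_punctured_nhds_of_continuousAt ?_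
    (hcont w hw)).differentiableAt.differentiableWithinAt
  filter_upwards [htends.eventually hne,
    mem_nhdsWithin_of_mem_nhds (isOpen_disc.mem_nhds hw)] with v hv hvd
  exact (HasDerivAt.of_local_left_inverse (hcont v hvd)
    (hd'.differentiableAt (isOpen_disc.mem_nhds (hbψ.mapsTo hvd))).hasDerivAt hv
    (by filter_upwards [isOpen_disc.mem_nhds hvd] with u hu using hinv.2 hu)).differentiableAt

theorem one_sub_normSq_mobius {a z : ℂ} (ha : a ∈ disc) (hz : z ∈ disc) :
    1 - ‖mobius a z‖ ^ 2 =
      (1 - ‖a‖ ^ 2) * (1 - ‖z‖ ^ 2) / ‖1 - (starRingEnd ℂ) a * z‖ ^ 2 := by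
  have hne : ‖1 - (starRingEnd ℂ) a * z‖ ≠ 0 :=
    norm_ne_zero_iff.2 (one_sub_conj_mul_ne_zero (mem_disc.1 ha).le (mem_disc.1 hz))
  rw [mobius, norm_div, ← normSq_one_sub_conj_mul_sub, sub_div, div_pow,
    div_self (pow_ne_zero 2 hne)]

theorem one_sub_normSq_mobius_pos {a z : ℂ} (ha : a ∈ disc) (hz : z ∈ disc) :
    0 < 1 - ‖mobius a z‖ ^ 2 := by
  have hne := norm_pos_iff.2 (one_sub_conj_mul_ne_zero (mem_disc.1 ha).le (mem_disc.1 hz))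
  rw [one_sub_normSq_mobius ha hz]
  have := one_sub_normSq_pos (mem_disc.1 ha)
  have := one_sub_normSq_pos (mem_disc.1 hz)
  positivity

theorem mobius_mem_disc {a z : ℂ} (ha : a ∈ disc) (hz : z ∈ disc) : mobius a z ∈ disc := by
  have := one_sub_normSq_mobius_pos ha hz
  rw [mem_disc]
  nlinarith [norm_nonneg (mobius a z)]

theorem mobius_mobius {a z : ℂ} (ha : a ∈ disc) (hz : z ∈ disc) : mobius a (mobius a z) = z := by
  have h1 := one_sub_conj_mul_ne_zero (mem_disc.1 ha).le (mem_disc.1 hz)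
  have h2 := one_sub_conj_mul_ne_zero (mem_disc.1 ha).le (mem_disc.1 (mobius_mem_disc ha hz))
  have h3 := one_sub_conj_mul_ne_zero (mem_disc.1 ha).le (mem_disc.1 ha)
  have e : (1 - (starRingEnd ℂ) a * mobius a z) =
      (1 - (starRingEnd ℂ) a * a) / (1 - (starRingEnd ℂ) a * z) := by
    rw [mobius, eq_div_iff h1, sub_mul, mul_assoc, div_mul_cancel₀ _ h1]; ring
  have e' : a - mobius a z = z * (1 - (starRingEnd ℂ) a * a) / (1 - (starRingEnd ℂ) a * z) := by
    rw [mobius, eq_div_iff h1, sub_mul, div_mul_cancel₀ _ h1]; ring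
  conv_lhs => rw [mobius, e, e']
  rw [div_div_div_cancel_right₀ h1, mul_div_cancel_right₀ _ h3]

theorem differentiableOn_mobius {a : ℂ} (ha : a ∈ disc) : DifferentiableOn ℂ (mobius a) disc := by
  intro z hz
  have := one_sub_conj_mul_ne_zero (mem_disc.1 ha).le (mem_disc.1 hz)
  unfold mobius
  fun_prop (disch := assumption)

theorem mobius_mem_discAut {a : ℂ} (ha : a ∈ disc) : mobius a ∈ discAut :=
  ⟨differentiableOn_mobius ha, Set.InvOn.bijOn (f' := mobius a)
    ⟨fun _ hz => mobius_mobius ha hz, fun _ hz => mobius_mobius ha hz⟩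
    (fun _ hz => mobius_mem_disc ha hz) fun _ hz => mobius_mem_disc ha hz⟩

theorem norm_le_of_mem_hol_of_mapsTo {f : ℂ → ℂ} (hd : DifferentiableOn ℂ f disc)
    (hm : Set.MapsTo f disc disc) (h0 : f 0 = 0) {z : ℂ} (hz : z ∈ disc) : ‖f z‖ ≤ ‖z‖ :=
  Complex.norm_le_norm_of_mapsTo_ball hd (fun _ hw => Metric.ball_subset_closedBall (hm hw)) h0
    (mem_disc.1 hz)

/-- Take a = φ⁻¹(0) and apply the Schwarz lemma to φ ∘ σ_a and σ_a ∘ φ⁻¹, which both fix 0. The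
potential is radial, so the unimodular factor between φ and σ_a is irrelevant. -/
theorem exists_norm_eq_norm_mobius {φ : ℂ → ℂ} (hφ : φ ∈ discAut) :
    ∃ a ∈ disc, ∀ z ∈ disc, ‖φ z‖ = ‖mobius a z‖ := by
  obtain ⟨ψ, hψ, hinv⟩ := exists_inverse_of_mem_discAut hφ
  have h0 : (0 : ℂ) ∈ disc := by simp [mem_disc]
  have ha : ψ 0 ∈ disc := hψ.2.mapsTo h0
  have hσ := mobius_mem_discAut ha
  have hd : DifferentiableOn ℂ φ disc := hφ.1
  have hd' : DifferentiableOn ℂ ψ disc := hψ.1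
  refine ⟨ψ 0, ha, fun z hz => le_antisymm ?_ ?_⟩
  · have := norm_le_of_mem_hol_of_mapsTo (f := φ ∘ mobius (ψ 0))
      (hd.comp (differentiableOn_mobius ha) hσ.2.mapsTo) (hφ.2.mapsTo.comp hσ.2.mapsTo)
      (by simpa [mobius] using (hinv 0 h0).2) (hσ.2.mapsTo hz)
    simpa [mobius_mobius ha hz] using this
  · have := norm_le_of_mem_hol_of_mapsTo (f := mobius (ψ 0) ∘ ψ)
      ((differentiableOn_mobius ha).comp hd' hψ.2.mapsTo) (hσ.2.mapsTo.comp hψ.2.mapsTo)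
      (by simp [mobius]) (hφ.2.mapsTo hz)
    simpa [(hinv z hz).1] using this

/-! ### Comparison of the two seminorms -/

theorem discAut_comp {φ ψ : ℂ → ℂ} (hφ : φ ∈ discAut) (hψ : ψ ∈ discAut) : φ ∘ ψ ∈ discAut :=
  ⟨DifferentiableOn.comp hφ.1 hψ.1 hψ.2.mapsTo, hφ.2.comp hψ.2⟩

/-- The Möbius invariant seminorm `sup_φ (∫ |f'|² U_μ(φ) dA)^{1/2}` of the function with
derivative `g`. -/
noncomputable def mSeminorm (μ : Measure ℂ) (g : ℂ → ℂ) : ℝ≥0∞ :=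
  ⨆ φ ∈ discAut, (∫⁻ w, ‖g w‖ₑ ^ 2 * potential μ (φ w) ∂areaMeasure) ^ (1 / 2 : ℝ)

/-- The seminorm `sup_a (∫ |f'|² (1 - |σ_a|²)^p dA)^{1/2}` of the function with derivative `g`. -/
noncomputable def qSeminorm (p : ℝ) (g : ℂ → ℂ) : ℝ≥0∞ :=
  ⨆ a ∈ disc,
    (∫⁻ z, ‖g z‖ₑ ^ 2 * ENNReal.ofReal ((1 - ‖mobius a z‖ ^ 2) ^ p) ∂areaMeasure) ^ (1 / 2 : ℝ)

theorem lintegral_potential_comp_discAut {p : ℝ} (hp0 : 0 < p) (hp1 : p < 1) (g : ℂ → ℂ)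
    {φ : ℂ → ℂ} {a : ℂ} (hφ : Set.MapsTo φ disc disc) (h : ∀ z ∈ disc, ‖φ z‖ = ‖mobius a z‖) :
    (∫⁻ w, ‖g w‖ₑ ^ 2 * potential (muP p) (φ w) ∂areaMeasure) ^ (1 / 2 : ℝ) =
      2 * (∫⁻ z, ‖g z‖ₑ ^ 2 * ENNReal.ofReal ((1 - ‖mobius a z‖ ^ 2) ^ p) ∂areaMeasure) ^
        (1 / 2 : ℝ) := by
  have e : ∫⁻ w, ‖g w‖ₑ ^ 2 * potential (muP p) (φ w) ∂areaMeasure =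
      4 * ∫⁻ z, ‖g z‖ₑ ^ 2 * ENNReal.ofReal ((1 - ‖mobius a z‖ ^ 2) ^ p) ∂areaMeasure := by
    rw [← lintegral_const_mul' _ _ (by norm_num)]
    refine lintegral_congr_ae ?_
    filter_upwards [areaMeasure_ae_mem_disc] with z hz
    rw [potential_muP hp0 hp1 (mem_disc.1 (hφ hz)), h z hz, ENNReal.ofReal_mul (by norm_num)]
    simp only [ENNReal.ofReal_ofNat]
    ring
  rw [e, ENNReal.mul_rpow_of_nonneg _ _ (by norm_num)]
  congr 1
  rw [show (4 : ℝ≥0∞) = 2 ^ (2 : ℝ) by norm_num, ← ENNReal.rpow_mul]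
  norm_num

theorem mSeminorm_muP {p : ℝ} (hp0 : 0 < p) (hp1 : p < 1) (g : ℂ → ℂ) :
    mSeminorm (muP p) g = 2 * qSeminorm p g := by
  rw [mSeminorm, qSeminorm]
  simp only [ENNReal.mul_iSup]
  refine le_antisymm (iSup₂_le fun φ hφ => ?_) (iSup₂_le fun a ha => ?_)
  · obtain ⟨a, ha, h⟩ := exists_norm_eq_norm_mobius hφ
    rw [lintegral_potential_comp_discAut hp0 hp1 g hφ.2.mapsTo h]
    exact le_iSup₂ (f := fun a (_ : a ∈ disc) => 2 * (∫⁻ z, ‖g z‖ₑ ^ 2 *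
      ENNReal.ofReal ((1 - ‖mobius a z‖ ^ 2) ^ p) ∂areaMeasure) ^ (1 / 2 : ℝ)) a ha
  · have hσ := mobius_mem_discAut ha
    rw [← lintegral_potential_comp_discAut hp0 hp1 g hσ.2.mapsTo fun _ _ => rfl]
    exact le_iSup₂ (f := fun φ (_ : φ ∈ discAut) =>
      (∫⁻ w, ‖g w‖ₑ ^ 2 * potential (muP p) (φ w) ∂areaMeasure) ^ (1 / 2 : ℝ)) _ hσ

theorem mNorm_eq (μ : Measure ℂ) (f : ℂ → ℂ) : mNorm μ f = ‖f 0‖ₑ + mSeminorm μ (deriv f) := rfl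

theorem qNorm_eq (p : ℝ) (f : ℂ → ℂ) : qNorm p f = ‖f 0‖ₑ + qSeminorm p (deriv f) := rfl

theorem QSpace_eq_MSpace {p : ℝ} (hp0 : 0 < p) (hp1 : p < 1) : QSpace p = MSpace (muP p) := by
  ext f
  simp only [QSpace, MSpace, Set.mem_ofPred_eq, mNorm_eq, qNorm_eq, mSeminorm_muP hp0 hp1,
    ENNReal.add_lt_top, ENNReal.mul_lt_top_iff]
  simp +contextual [lt_top_iff_ne_top]

/-- Carries a pointwise bound between derivatives over to the seminorms, for any measure. -/
theorem mSeminorm_le_mul (μ : Measure ℂ) {g h : ℂ → ℂ} {M : ℝ≥0∞} (hM : M ≠ ∞)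
    (hle : ∀ z ∈ disc, ‖g z‖ₑ ≤ M * ‖h z‖ₑ) : mSeminorm μ g ≤ M * mSeminorm μ h := by
  refine iSup₂_le fun φ hφ => ?_
  refine le_trans ?_ (mul_le_mul_right (le_iSup₂ (f := fun φ (_ : φ ∈ discAut) =>
      (∫⁻ w, ‖h w‖ₑ ^ 2 * potential μ (φ w) ∂areaMeasure) ^ (1 / 2 : ℝ)) φ hφ) M)
  have e : M = (M ^ 2) ^ (1 / 2 : ℝ) := by
    rw [← ENNReal.rpow_natCast, ← ENNReal.rpow_mul]; norm_num
  conv_rhs => rw [e]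
  rw [← ENNReal.mul_rpow_of_nonneg _ _ (by norm_num),
    ← lintegral_const_mul' _ _ (ENNReal.pow_ne_top hM)]
  refine ENNReal.rpow_le_rpow (lintegral_mono_ae ?_) (by norm_num)
  filter_upwards [areaMeasure_ae_mem_disc] with z hz
  rw [← mul_assoc, ← mul_pow]
  gcongr
  exact hle z hz

/-! ### Membership of log(1 - z) in the space -/

theorem norm_sub_le_norm_one_sub_conj_mul {a z : ℂ} (ha : a ∈ disc) (hz : z ∈ disc) :
    ‖a - z‖ ≤ ‖1 - (starRingEnd ℂ) a * z‖ := by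
  have h := normSq_one_sub_conj_mul_sub a z
  have := mul_pos (one_sub_normSq_pos (mem_disc.1 ha)) (one_sub_normSq_pos (mem_disc.1 hz))
  exact (sq_le_sq₀ (norm_nonneg _) (norm_nonneg _)).1 (by linarith)

theorem one_sub_normSq_le {z : ℂ} (hz : z ∈ disc) : 1 - ‖z‖ ^ 2 ≤ 2 * ‖1 - z‖ := by
  have h1 := mem_disc.1 hz
  have h2 : 1 - ‖z‖ ≤ ‖1 - z‖ := by simpa using norm_sub_norm_le (1 : ℂ) z
  nlinarith [norm_nonneg z]

theorem norm_one_sub_pos {z : ℂ} (hz : z ∈ disc) : 0 < ‖1 - z‖ := by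
  have h2 : 1 - ‖z‖ ≤ ‖1 - z‖ := by simpa using norm_sub_norm_le (1 : ℂ) z
  linarith [mem_disc.1 hz]

theorem one_sub_normSq_mobius_le_one (a z : ℂ) : 1 - ‖mobius a z‖ ^ 2 ≤ 1 := by
  linarith [sq_nonneg ‖mobius a z‖]

/-- From 1 - |z|² ≤ 2|1 - z| the left side is at most 4|1 - a||1 - z| / |1 - conj a · z|², and the
denominator dominates the square of |1 - a| - |1 - z|. If one distance is at least twice the other,
|1 - conj a · z| is at least half the larger, which gives 16; otherwise both ratios exceed 1/2 and
the trivial bound 1 suffices. -/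
theorem one_sub_normSq_mobius_le {a z : ℂ} (ha : a ∈ disc) (hz : z ∈ disc) :
    1 - ‖mobius a z‖ ^ 2 ≤ 16 * min (‖1 - z‖ / ‖1 - a‖) (‖1 - a‖ / ‖1 - z‖) := by
  have hd := norm_one_sub_pos ha
  have hr := norm_one_sub_pos hz
  have hle : 1 - ‖mobius a z‖ ^ 2 ≤
      4 * (‖1 - a‖ * ‖1 - z‖) / ‖1 - (starRingEnd ℂ) a * z‖ ^ 2 := by
    rw [one_sub_normSq_mobius ha hz]
    have h1 := one_sub_normSq_le ha
    have h2 := one_sub_normSq_le hz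
    have h3 := one_sub_normSq_pos (mem_disc.1 hz)
    have h4 := mul_le_mul h1 h2 h3.le (by positivity)
    exact div_le_div_of_nonneg_right (by linarith) (by positivity)
  have h1 := one_sub_normSq_mobius_le_one a z
  have hk := norm_sub_le_norm_one_sub_conj_mul ha hz
  have t1 : ‖1 - z‖ - ‖1 - a‖ ≤ ‖a - z‖ := by
    have := norm_sub_norm_le (1 - z) (1 - a)
    rwa [show 1 - z - (1 - a) = a - z by ring] at this
  have t2 : ‖1 - a‖ - ‖1 - z‖ ≤ ‖a - z‖ := by
    have := norm_sub_norm_le (1 - a) (1 - z)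
    rwa [show 1 - a - (1 - z) = -(a - z) by ring, norm_neg] at this
  generalize ‖1 - a‖ = d at *
  generalize ‖1 - z‖ = r at *
  generalize ‖1 - (starRingEnd ℂ) a * z‖ = k at *
  generalize 1 - ‖mobius a z‖ ^ 2 = x at *
  rw [mul_min_of_nonneg _ _ (by norm_num), le_min_iff]
  have key : ∀ {d r : ℝ}, 0 < d → 0 < r → r - d ≤ k → x ≤ 4 * (d * r) / k ^ 2 →
      x ≤ 16 * (d / r) := by
    intro d r hd hr ht hle
    rcases le_or_gt (2 * d) r with h | h
    · have hk' : r / 2 ≤ k := by linarith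
      refine hle.trans ?_
      calc 4 * (d * r) / k ^ 2 ≤ 4 * (d * r) / (r / 2) ^ 2 := by gcongr
        _ = 16 * (d / r) := by field_simp; ring
    · refine h1.trans ?_
      rw [← mul_div_assoc, le_div_iff₀ hr]
      linarith
  exact ⟨key hr hd (t2.trans hk) (by rwa [mul_comm r d]), key hd hr (t1.trans hk) hle⟩

/-- The measure dr / r is dilation invariant, hence a bound free of d; (0, d] and (d, ∞) contribute
at most 1 / p each. -/
theorem lintegral_min_rpow_div_le {p d : ℝ} (hp0 : 0 < p) (hd : 0 < d) :
    ∫⁻ r in Set.Ioi (0 : ℝ), ENNReal.ofReal (min (r / d) (d / r) ^ p / r) ≤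
      ENNReal.ofReal (2 / p) := by
  have hsplit : Set.Ioi (0 : ℝ) = Set.Ioc 0 d ∪ Set.Ioi d := (Set.Ioc_union_Ioi_eq_Ioi hd.le).symm
  have h1 : ∫⁻ r in Set.Ioc 0 d, ENNReal.ofReal (min (r / d) (d / r) ^ p / r) ≤
      ENNReal.ofReal (1 / p) := by
    have hi : IntegrableOn (fun r : ℝ => r ^ (p - 1) / d ^ p) (Set.Ioc 0 d) :=
      ((intervalIntegrable_iff_integrableOn_Ioc_of_le hd.le).1
        (intervalIntegral.intervalIntegrable_rpow' (by linarith))).div_const _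
    calc _ ≤ ∫⁻ r in Set.Ioc 0 d, ENNReal.ofReal (r ^ (p - 1) / d ^ p) := by
          refine setLIntegral_mono' measurableSet_Ioc fun r hr => ENNReal.ofReal_le_ofReal ?_
          have hr0 : 0 < r := hr.1
          calc min (r / d) (d / r) ^ p / r ≤ (r / d) ^ p / r := by
                have : 0 ≤ min (r / d) (d / r) := by positivity
                gcongr
                exact min_le_left _ _
            _ = r ^ (p - 1) / d ^ p := by
                rw [Real.div_rpow hr0.le hd.le, Real.rpow_sub_one hr0.ne']
                field_simp
      _ = ENNReal.ofReal (1 / p) := by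
          rw [← ofReal_integral_eq_lintegral_ofReal hi]
          · rw [integral_div, ← intervalIntegral.integral_of_le hd.le,
              integral_rpow (Or.inl (by linarith))]
            have : d ^ p ≠ 0 := by positivity
            simp [Real.zero_rpow hp0.ne']
            field_simp
          · filter_upwards [ae_restrict_mem measurableSet_Ioc] with r hr
            have hr0 : 0 < r := hr.1
            simp only [Pi.zero_apply]
            positivity
  have h2 : ∫⁻ r in Set.Ioi d, ENNReal.ofReal (min (r / d) (d / r) ^ p / r) ≤
      ENNReal.ofReal (1 / p) := by
    have hi : IntegrableOn (fun r : ℝ => d ^ p * r ^ (-p - 1)) (Set.Ioi d) :=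
      (integrableOn_Ioi_rpow_of_lt (by linarith) hd).const_mul _
    calc _ ≤ ∫⁻ r in Set.Ioi d, ENNReal.ofReal (d ^ p * r ^ (-p - 1)) := by
          refine setLIntegral_mono' measurableSet_Ioi fun r hr => ENNReal.ofReal_le_ofReal ?_
          have hr0 : 0 < r := hd.trans hr
          calc min (r / d) (d / r) ^ p / r ≤ (d / r) ^ p / r := by
                have : 0 ≤ min (r / d) (d / r) := by positivity
                gcongr
                exact min_le_right _ _
            _ = d ^ p * r ^ (-p - 1) := by
                rw [Real.div_rpow hd.le hr0.le, Real.rpow_sub_one hr0.ne', Real.rpow_neg hr0.le]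
                field_simp
      _ = ENNReal.ofReal (1 / p) := by
          rw [← ofReal_integral_eq_lintegral_ofReal hi]
          · rw [integral_const_mul, integral_Ioi_rpow_of_lt (by linarith) hd]
            have : d ^ p ≠ 0 := by positivity
            simp [Real.rpow_neg hd.le]
            field_simp
          · filter_upwards [ae_restrict_mem measurableSet_Ioi] with r hr
            have hr0 : 0 < r := hd.trans hr
            simp only [Pi.zero_apply]
            positivity
  rw [hsplit]
  calc _ ≤ _ := lintegral_union_le _ _ _
    _ ≤ ENNReal.ofReal (1 / p) + ENNReal.ofReal (1 / p) := add_le_add h1 h2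
    _ = _ := by rw [← ENNReal.ofReal_add (by positivity) (by positivity)]; congr 1; ring

theorem hasDerivAt_logOneSub {z : ℂ} (hz : z ∈ disc) : HasDerivAt logOneSub (-1 / (1 - z)) z := by
  have : 1 - z ∈ Complex.slitPlane := by
    refine Complex.mem_slitPlane_iff.2 (Or.inl ?_)
    have := (Complex.re_le_norm z).trans_lt (mem_disc.1 hz)
    simpa using this
  exact (((hasDerivAt_id z).const_sub 1).clog this)

theorem enorm_deriv_logOneSub {z : ℂ} (hz : z ∈ disc) :
    ‖deriv logOneSub z‖ₑ = ENNReal.ofReal (1 / ‖1 - z‖) := by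
  rw [(hasDerivAt_logOneSub hz).deriv, ← ofReal_norm]
  simp

/-- In polar coordinates centred at the boundary point 1, |f'|² dA is a multiple of dr / r dθ, and
the kernel bound depends on r alone; the resulting estimate is uniform in a. -/
theorem logOneSub_mem_QSpace {p : ℝ} (hp0 : 0 < p) : logOneSub ∈ QSpace p := by
  refine ⟨fun z hz => (hasDerivAt_logOneSub hz).differentiableAt.differentiableWithinAt, ?_⟩
  rw [qNorm_eq]
  have h0 : ‖logOneSub 0‖ₑ = 0 := by simp [logOneSub]
  rw [h0, zero_add]
  -- Kernel constant 16^p, angular integral 2π, radial integral 2 / p.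
  let C : ℝ≥0∞ := ENNReal.ofReal (16 ^ p) *
    (ENNReal.ofReal (2 * Real.pi) * ENNReal.ofReal (2 / p))
  have hC : (ENNReal.ofReal Real.pi)⁻¹ * C < ∞ := by
    refine ENNReal.mul_lt_top (ENNReal.inv_lt_top.2 (by simpa using Real.pi_pos)) ?_
    exact ENNReal.mul_lt_top ENNReal.ofReal_lt_top
      (ENNReal.mul_lt_top ENNReal.ofReal_lt_top ENNReal.ofReal_lt_top)
  refine lt_of_le_of_lt (iSup₂_le fun a ha => ENNReal.rpow_le_rpow ?_ (by norm_num))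
    (ENNReal.rpow_lt_top_of_nonneg (by norm_num : (0 : ℝ) ≤ 1 / 2) hC.ne)
  have hd := norm_one_sub_pos ha
  let F : ℂ → ℝ≥0∞ := fun w =>
    ENNReal.ofReal (min (‖w‖ / ‖1 - a‖) (‖1 - a‖ / ‖w‖) ^ p / ‖w‖ ^ 2)
  have hF : Measurable F := by fun_prop
  rw [areaMeasure, lintegral_smul_measure, smul_eq_mul]
  refine mul_le_mul_right ?_ _
  calc _ ≤ ∫⁻ z in disc, ENNReal.ofReal (16 ^ p) * F (1 - z) := by
        refine setLIntegral_mono' measurableSet_disc fun z hz => ?_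
        have hr := norm_one_sub_pos hz
        rw [enorm_deriv_logOneSub hz, ← ENNReal.ofReal_pow (by positivity),
          ← ENNReal.ofReal_mul (by positivity), ← ENNReal.ofReal_mul (by positivity)]
        refine ENNReal.ofReal_le_ofReal ?_
        have h1 := one_sub_normSq_mobius_le ha hz
        have h2 := one_sub_normSq_mobius_pos ha hz
        have h3 : 0 ≤ min (‖1 - z‖ / ‖1 - a‖) (‖1 - a‖ / ‖1 - z‖) := by positivity
        calc (1 / ‖1 - z‖) ^ 2 * (1 - ‖mobius a z‖ ^ 2) ^ p
            ≤ (1 / ‖1 - z‖) ^ 2 *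
              (16 * min (‖1 - z‖ / ‖1 - a‖) (‖1 - a‖ / ‖1 - z‖)) ^ p := by gcongr
          _ = _ := by
            rw [Real.mul_rpow (by norm_num) h3]
            field_simp
    _ ≤ ∫⁻ z, ENNReal.ofReal (16 ^ p) * F (1 - z) := setLIntegral_le_lintegral _ _
    _ = ENNReal.ofReal (16 ^ p) * ∫⁻ z, F z := by
        rw [lintegral_const_mul' _ _ ENNReal.ofReal_ne_top, lintegral_sub_left_eq_self]
    _ ≤ C := by
        refine mul_le_mul_right ?_ _
        rw [lintegral_eq_lintegral_polar hF]
        refine le_trans (le_of_eq ?_) (mul_le_mul_right (lintegral_min_rpow_div_le hp0 hd) _)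
        rw [← lintegral_const_mul' _ _ ENNReal.ofReal_ne_top]
        refine setLIntegral_congr_fun measurableSet_Ioi fun r hr => ?_
        have hr0 : 0 < r := hr
        have hm : 0 ≤ min (r / ‖1 - a‖) (‖1 - a‖ / r) := by positivity
        simp only [F, norm_circleMap_zero, abs_of_pos hr0, lintegral_const,
          Measure.restrict_apply_univ, Real.volume_Ioo]
        rw [← ENNReal.ofReal_mul (by positivity), ← ENNReal.ofReal_mul hr0.le,
          ← ENNReal.ofReal_mul (by positivity)]
        congr 1
        field_simp
        ring

/-! ### Square-summable Taylor coefficients and the Hilbert series -/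

theorem hasSum_taylorCoeff {f : ℂ → ℂ} (hf : DifferentiableOn ℂ f disc) {z : ℂ} (hz : z ∈ disc) :
    HasSum (fun k => taylorCoeff f k * z ^ k) (f z) := by
  have := Complex.hasSum_taylorSeries_on_ball hf hz
  refine this.congr_fun ?_
  intro k
  simp [taylorCoeff]
  ring

/-- Bessel's inequality; Haar measure on the circle has mass 1, so the L² norm is at most the sup
norm. -/
theorem sum_sq_norm_fourier_le {T : ℝ} [Fact (0 < T)] {c : ℕ → ℂ} {F : C(AddCircle T, ℂ)}
    (hF : HasSum (fun k : ℕ => c k • (fourier k : C(AddCircle T, ℂ))) F) {M : ℝ}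
    (hFn : ‖F‖ ≤ M) (N : ℕ) : ∑ k ∈ Finset.range N, ‖c k‖ ^ 2 ≤ M ^ 2 := by
  let L := ContinuousMap.toLp (E := ℂ) 2 (AddCircle.haarAddCircle (T := T)) ℂ
  have hLn : ‖L F‖ ≤ M := by
    refine (L.le_opNorm F).trans ?_
    have : ‖L‖ ≤ 1 := by
      refine (ContinuousMap.toLp_norm_le (AddCircle.haarAddCircle (T := T))).trans ?_
      simp [measureUnivNNReal]
    nlinarith [norm_nonneg F, norm_nonneg L]
  have hTF : HasSum (fun k : ℕ => c k • fourierLp (T := T) 2 k) (L F) := by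
    have h := L.hasSum hF
    simp only [map_smul] at h
    exact h
  have hinner : ∀ k : ℕ, inner ℂ (fourierLp (T := T) 2 k) (L F) = c k := by
    intro k
    have h2 := (innerSL ℂ (fourierLp (T := T) 2 k)).hasSum hTF
    refine h2.unique ?_
    have horth := orthonormal_iff_ite.1 (orthonormal_fourier (T := T)) k
    simp only [map_smul, innerSL_apply_apply, horth, smul_eq_mul]
    refine (hasSum_ite_eq k (c k)).congr_fun fun j => ?_
    by_cases h : j = k
    · simp [h]
    · simp [h, Ne.symm h]
  have horth' : Orthonormal ℂ fun k : ℕ => fourierLp (T := T) 2 (k : ℤ) :=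
    orthonormal_fourier.comp _ Nat.cast_injective
  have := horth'.sum_inner_products_le (L F) (s := Finset.range N)
  simp only [hinner] at this
  exact this.trans (by gcongr)

theorem sum_sq_norm_taylorCoeff_mul_pow_le {f : ℂ → ℂ} (hf : DifferentiableOn ℂ f disc) {M : ℝ}
    (hM0 : 0 ≤ M) (hM : ∀ z ∈ disc, ‖f z‖ ≤ M) {r : ℝ} (h0 : 0 ≤ r) (h1 : r < 1) (N : ℕ) :
    ∑ k ∈ Finset.range N, (‖taylorCoeff f k‖ * r ^ k) ^ 2 ≤ M ^ 2 := by
  have : Fact (0 < 2 * Real.pi) := ⟨Real.two_pi_pos⟩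
  let c : ℕ → ℂ := fun k => taylorCoeff f k * (r : ℂ) ^ k
  have hcs : Summable fun k => ‖c k‖ := by
    have := (hasSum_taylorCoeff hf (z := r)
      (by simpa [mem_disc, abs_of_nonneg h0] using h1)).summable
    exact this.norm
  have hs : Summable fun k : ℕ => c k • (fourier k : C(AddCircle (2 * Real.pi), ℂ)) := by
    refine Summable.of_norm ?_
    simpa only [norm_smul, fourier_norm, mul_one] using hcs
  obtain ⟨F, hF⟩ := hs
  have hFval : ∀ x, ‖F x‖ ≤ M := by
    intro x
    have hx : (r : ℂ) * (AddCircle.toCircle x : ℂ) ∈ disc := by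
      rw [mem_disc, norm_mul, Circle.norm_coe, mul_one, Complex.norm_real,
        Real.norm_of_nonneg h0]
      exact h1
    have h2 := (ContinuousMap.evalCLM ℂ x).hasSum hF
    have h3 := hasSum_taylorCoeff hf hx
    have : F x = f ((r : ℂ) * (AddCircle.toCircle x : ℂ)) := by
      refine h2.unique (h3.congr_fun fun k => ?_)
      simp [c, fourier_apply, AddCircle.toCircle_nsmul, mul_pow, mul_assoc]
    rw [this]
    exact hM _ hx
  refine le_trans (le_of_eq ?_)
    (sum_sq_norm_fourier_le hF ((ContinuousMap.norm_le _ hM0).2 hFval) N)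
  refine Finset.sum_congr rfl fun k _ => ?_
  simp [c, abs_of_nonneg h0]

/-- Each partial sum is a polynomial in r bounded by M² for r < 1, so the bound persists at r = 1.
-/
theorem summable_sq_norm_taylorCoeff {f : ℂ → ℂ} (hf : DifferentiableOn ℂ f disc) {M : ℝ}
    (hM0 : 0 ≤ M) (hM : ∀ z ∈ disc, ‖f z‖ ≤ M) : Summable fun k => ‖taylorCoeff f k‖ ^ 2 := by
  refine summable_of_sum_range_le (c := M ^ 2) (fun _ => by positivity) fun N => ?_
  have hc : Continuous fun r : ℝ => ∑ k ∈ Finset.range N, (‖taylorCoeff f k‖ * r ^ k) ^ 2 := by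
    fun_prop
  have ht := (hc.tendsto 1).mono_left (nhdsWithin_le_nhds (s := Set.Iio 1))
  simp only [one_pow, mul_one] at ht
  refine le_of_tendsto ht ?_
  filter_upwards [Ioo_mem_nhdsLT (zero_lt_one' ℝ)] with r hr
  exact sum_sq_norm_taylorCoeff_mul_pow_le hf hM0 hM hr.1.le hr.2 N

theorem summable_norm_taylorCoeff_div {f : ℂ → ℂ} (hf : DifferentiableOn ℂ f disc) {M : ℝ}
    (hM0 : 0 ≤ M) (hM : ∀ z ∈ disc, ‖f z‖ ≤ M) :
    Summable fun k : ℕ => ‖taylorCoeff f k‖ / (k + 1) := by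
  have h2 : Summable fun k : ℕ => (1 / ((k : ℝ) + 1)) ^ 2 := by
    have := (summable_nat_add_iff 1).2 (Real.summable_one_div_nat_pow.2 (one_lt_two))
    simpa using this
  refine Summable.of_nonneg_of_le (fun k => by positivity) (fun k => ?_)
    (((summable_sq_norm_taylorCoeff hf hM0 hM).add h2).mul_left (1 / 2))
  rw [div_eq_mul_one_div]
  nlinarith [sq_nonneg (‖taylorCoeff f k‖ - 1 / ((k : ℝ) + 1))]

theorem norm_hilbertTerm (f : ℂ → ℂ) (n k : ℕ) :
    ‖hilbertTerm f n k‖ = ‖taylorCoeff f k‖ / (k + n + 1) := by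
  rw [hilbertTerm, norm_div]
  congr 1
  have : (k : ℂ) + n + 1 = ((k + n + 1 : ℕ) : ℂ) := by push_cast; ring
  rw [this, Complex.norm_natCast]
  push_cast; ring

theorem summable_norm_hilbertTerm {f : ℂ → ℂ} (hf : DifferentiableOn ℂ f disc) {M : ℝ}
    (hM0 : 0 ≤ M) (hM : ∀ z ∈ disc, ‖f z‖ ≤ M) (n : ℕ) :
    Summable fun k => ‖hilbertTerm f n k‖ := by
  refine Summable.of_nonneg_of_le (fun k => norm_nonneg _) (fun k => ?_)
    (summable_norm_taylorCoeff_div hf hM0 hM)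
  rw [norm_hilbertTerm]
  gcongr
  simp

/-! ### Integral representation of the Hilbert operator -/

theorem ofReal_mem_disc {t : ℝ} (ht : t ∈ Set.Ioo (0 : ℝ) 1) : (t : ℂ) ∈ disc := by
  simpa [mem_disc, abs_of_pos ht.1] using ht.2

theorem aestronglyMeasurable_comp_ofReal {f : ℂ → ℂ} (hf : DifferentiableOn ℂ f disc) :
    AEStronglyMeasurable (fun t : ℝ => f t) (volume.restrict (Set.Ioo 0 1)) := by
  refine ContinuousOn.aestronglyMeasurable ?_ measurableSet_Ioo
  exact hf.continuousOn.comp Complex.continuous_ofReal.continuousOn fun t ht => ofReal_mem_disc ht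

theorem integrable_mul_of_norm_le {f : ℂ → ℂ} (hf : DifferentiableOn ℂ f disc) {M : ℝ}
    (hM : ∀ z ∈ disc, ‖f z‖ ≤ M) {h : ℝ → ℂ} (hh : ContinuousOn h (Set.Icc 0 1)) :
    Integrable (fun t : ℝ => f t * h t) (volume.restrict (Set.Ioo 0 1)) := by
  have hi : IntegrableOn h (Set.Ioo 0 1) :=
    (hh.integrableOn_compact isCompact_Icc).mono_set Set.Ioo_subset_Icc_self
  refine hi.bdd_mul (c := M) (aestronglyMeasurable_comp_ofReal hf) ?_
  filter_upwards [ae_restrict_mem measurableSet_Ioo] with t ht using hM _ (ofReal_mem_disc ht)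

/-- Write 1 / (k + n + 1) as the integral of t^(k + n); absolute convergence of the coefficient
series permits the interchange. -/
theorem hilbertCoeff_eq_integral {f : ℂ → ℂ} (hf : DifferentiableOn ℂ f disc) {M : ℝ}
    (hM0 : 0 ≤ M) (hM : ∀ z ∈ disc, ‖f z‖ ≤ M) (n : ℕ) :
    hilbertCoeff f n = ∫ t : ℝ in Set.Ioo 0 1, f t * (t : ℂ) ^ n := by
  have hpow : ∀ m : ℕ, ∫ t : ℝ in Set.Ioo 0 1, t ^ m = 1 / ((m : ℝ) + 1) := fun m => by
    rw [← integral_Ioc_eq_integral_Ioo, ← intervalIntegral.integral_of_le zero_le_one,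
      integral_pow]
    simp
  have hint : ∀ m : ℕ, IntegrableOn (fun t : ℝ => (t : ℂ) ^ m) (Set.Ioo 0 1) := fun m =>
    ((by fun_prop : Continuous fun t : ℝ => (t : ℂ) ^ m).continuousOn.integrableOn_compact
      isCompact_Icc).mono_set Set.Ioo_subset_Icc_self
  have hval : ∀ k : ℕ, ∫ t : ℝ in Set.Ioo 0 1, taylorCoeff f k * (t : ℂ) ^ (k + n) =
      hilbertTerm f n k := fun k => by
    rw [integral_const_mul, hilbertTerm, div_eq_mul_one_div]
    congr 1
    have := congrArg (fun x : ℝ => (x : ℂ)) (hpow (k + n))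
    rw [← integral_complex_ofReal] at this
    simpa using this
  have hval' : ∀ k : ℕ, ∫ t : ℝ in Set.Ioo 0 1, ‖taylorCoeff f k * (t : ℂ) ^ (k + n)‖ =
      ‖hilbertTerm f n k‖ := fun k => by
    rw [norm_hilbertTerm, div_eq_mul_one_div]
    have := hpow (k + n)
    push_cast at this
    rw [← this, ← integral_const_mul]
    refine setIntegral_congr_fun measurableSet_Ioo fun t ht => ?_
    simp [abs_of_pos ht.1]
  have h := hasSum_integral_of_summable_integral_norm
    (F := fun (k : ℕ) (t : ℝ) => taylorCoeff f k * (t : ℂ) ^ (k + n))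
    (μ := volume.restrict (Set.Ioo 0 1)) (fun k => (hint _).const_mul _)
    (by simpa only [hval'] using summable_norm_hilbertTerm hf hM0 hM n)
  simp only [hval] at h
  rw [hilbertCoeff, h.tsum_eq]
  refine setIntegral_congr_fun measurableSet_Ioo fun t ht => ?_
  have := (hasSum_taylorCoeff hf (ofReal_mem_disc ht)).mul_right ((t : ℂ) ^ n)
  simpa [pow_add, mul_assoc] using this.tsum_eq

theorem hasSum_hilbertCoeff {f : ℂ → ℂ} (hf : DifferentiableOn ℂ f disc) {M : ℝ}
    (hM0 : 0 ≤ M) (hM : ∀ z ∈ disc, ‖f z‖ ≤ M) {z : ℂ} (hz : z ∈ disc) :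
    HasSum (fun n => hilbertCoeff f n * z ^ n)
      (∫ t : ℝ in Set.Ioo 0 1, f t * (1 - t * z)⁻¹) := by
  have hb : ∀ n : ℕ, ∫ t : ℝ in Set.Ioo 0 1, ‖f t * ((t : ℂ) ^ n * z ^ n)‖ ≤ M * ‖z‖ ^ n := by
    intro n
    have : ∀ t ∈ Set.Ioo (0 : ℝ) 1, ‖‖f t * ((t : ℂ) ^ n * z ^ n)‖‖ ≤ M * ‖z‖ ^ n := by
      intro t ht
      have h1 := hM _ (ofReal_mem_disc ht)
      have h2 : t ^ n ≤ 1 := pow_le_one₀ ht.1.le ht.2.le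
      have h3 := pow_pos ht.1 n
      rw [norm_norm, norm_mul, norm_mul, norm_pow, norm_pow, Complex.norm_real,
        Real.norm_of_nonneg ht.1.le]
      gcongr
      exact mul_le_of_le_one_left (by positivity) h2
    refine (Real.le_norm_self _).trans ((norm_setIntegral_le_of_norm_le_const (μ := volume) (by simp) this).trans ?_)
    simp
  have h := hasSum_integral_of_summable_integral_norm
    (F := fun (n : ℕ) (t : ℝ) => f t * ((t : ℂ) ^ n * z ^ n))
    (μ := volume.restrict (Set.Ioo 0 1))
    (fun n => integrable_mul_of_norm_le hf hM (by fun_prop))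
    (Summable.of_nonneg_of_le (fun n => integral_nonneg fun t => norm_nonneg _) hb
      ((summable_geometric_of_lt_one (norm_nonneg z) (mem_disc.1 hz)).mul_left M))
  have e1 : ∀ n : ℕ, ∫ t : ℝ in Set.Ioo 0 1, f t * ((t : ℂ) ^ n * z ^ n) =
      hilbertCoeff f n * z ^ n := fun n => by
    rw [hilbertCoeff_eq_integral hf hM0 hM, ← integral_mul_const]
    simp only [mul_assoc]
  simp only [e1] at h
  suffices e : ∫ t : ℝ in Set.Ioo 0 1, f t * (1 - t * z)⁻¹ =
      ∫ t : ℝ in Set.Ioo 0 1, ∑' n : ℕ, f t * ((t : ℂ) ^ n * z ^ n) from e ▸ h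
  refine setIntegral_congr_fun measurableSet_Ioo fun t ht => ?_
  have hlt : ‖(t : ℂ) * z‖ < 1 := by
    have h1 := mem_disc.1 (ofReal_mem_disc ht)
    have h2 := mem_disc.1 hz
    rw [norm_mul]
    nlinarith [norm_nonneg z, norm_nonneg (t : ℂ)]
  have := (hasSum_geometric_of_norm_lt_one hlt).mul_left (f t)
  simp only [mul_pow] at this
  exact this.tsum_eq.symm

theorem hilbertOp_eq_integral {f : ℂ → ℂ} (hf : DifferentiableOn ℂ f disc) {M : ℝ}
    (hM0 : 0 ≤ M) (hM : ∀ z ∈ disc, ‖f z‖ ≤ M) {z : ℂ} (hz : z ∈ disc) :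
    hilbertOp f z = ∫ t : ℝ in Set.Ioo 0 1, f t * (1 - t * z)⁻¹ :=
  (hasSum_hilbertCoeff hf hM0 hM hz).tsum_eq

theorem norm_one_sub_mul_ge {t : ℝ} (h0 : 0 ≤ t) (h1 : t ≤ 1) (z : ℂ) :
    1 - ‖z‖ ≤ ‖1 - (t : ℂ) * z‖ := by
  have h2 : 1 - ‖(t : ℂ) * z‖ ≤ ‖1 - (t : ℂ) * z‖ := by
    simpa using norm_sub_norm_le (1 : ℂ) (t * z)
  have h3 : ‖(t : ℂ) * z‖ ≤ ‖z‖ := by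
    rw [norm_mul, Complex.norm_real, Real.norm_of_nonneg h0]
    exact mul_le_of_le_one_left (norm_nonneg z) h1
  linarith

theorem hasDerivAt_hilbertOp {f : ℂ → ℂ} (hf : DifferentiableOn ℂ f disc) {M : ℝ}
    (hM0 : 0 ≤ M) (hM : ∀ z ∈ disc, ‖f z‖ ≤ M) {z : ℂ} (hz : z ∈ disc) :
    HasDerivAt (hilbertOp f) (∫ t : ℝ in Set.Ioo 0 1, t * f t / (1 - t * z) ^ 2) z := by
  have hz1 := mem_disc.1 hz
  -- On |w| < ρ < 1 the differentiated integrand is dominated by M / (1 - ρ)².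
  obtain ⟨ρ, hρ, hρ1⟩ := exists_between hz1
  have hs : Metric.ball (0 : ℂ) ρ ∈ nhds z :=
    Metric.isOpen_ball.mem_nhds (by simpa using hρ)
  have hne : ∀ t ∈ Set.Icc (0 : ℝ) 1, ∀ w : ℂ, ‖w‖ < 1 → 1 - (t : ℂ) * w ≠ 0 := fun t ht w hw =>
    norm_pos_iff.1 ((by linarith : 0 < 1 - ‖w‖).trans_le (norm_one_sub_mul_ge ht.1 ht.2 w))
  have hint : ∀ w ∈ disc, Integrable (fun t : ℝ => f t * (1 - t * w)⁻¹)
      (volume.restrict (Set.Ioo 0 1)) := fun w hw =>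
    integrable_mul_of_norm_le hf hM (ContinuousOn.inv₀ (by fun_prop)
      fun t ht => hne t ht w (mem_disc.1 hw))
  have hint' : Integrable (fun t : ℝ => f t * (t / (1 - t * z) ^ 2))
      (volume.restrict (Set.Ioo 0 1)) :=
    integrable_mul_of_norm_le hf hM (ContinuousOn.div (by fun_prop) (by fun_prop)
      fun t ht => pow_ne_zero 2 (hne t ht z hz1))
  have key := hasDerivAt_integral_of_dominated_loc_of_deriv_le (𝕜 := ℂ)
    (μ := volume.restrict (Set.Ioo (0 : ℝ) 1))
    (F := fun w t => f t * (1 - t * w)⁻¹) (F' := fun w t => f t * (t / (1 - t * w) ^ 2))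
    (bound := fun _ => M * (1 / (1 - ρ) ^ 2)) hs
    (by filter_upwards [isOpen_disc.mem_nhds hz] with w hw using (hint w hw).aestronglyMeasurable)
    (hint z hz) hint'.aestronglyMeasurable ?_ (integrable_const _) ?_
  · refine (key.2.congr_of_eventuallyEq ?_).congr_deriv ?_
    · filter_upwards [isOpen_disc.mem_nhds hz] with w hw
      exact hilbertOp_eq_integral hf hM0 hM hw
    · refine setIntegral_congr_fun measurableSet_Ioo fun t _ => ?_
      ring
  · filter_upwards [ae_restrict_mem measurableSet_Ioo] with t ht w hw
    have hw' : ‖w‖ < ρ := by simpa using hw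
    have h1 := norm_one_sub_mul_ge ht.1.le ht.2.le w
    have h2 : 0 < 1 - ρ := by linarith
    have h3 := hM _ (ofReal_mem_disc ht)
    have h4 := ht.1
    rw [norm_mul, norm_div, norm_pow, Complex.norm_real, Real.norm_of_nonneg ht.1.le]
    gcongr
    · exact ht.2.le
    · linarith
  · filter_upwards [ae_restrict_mem measurableSet_Ioo] with t ht w hw
    have hw' : ‖w‖ < ρ := by simpa using hw
    have h := hne t (Set.Ioo_subset_Icc_self ht) w (hw'.trans hρ1)
    have h1 : HasDerivAt (fun w : ℂ => 1 - (t : ℂ) * w) (-((t : ℂ) * 1)) w :=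
      ((hasDerivAt_id w).const_mul (t : ℂ)).const_sub 1
    refine ((h1.inv h).const_mul (f t)).congr_deriv ?_
    simp

/-! ### The derivative bound by deformation to an arc -/

/-- The point `s / (1 - (1 - s) z)` of the circular arc from `0` to `1`. -/
noncomputable def arc (z : ℂ) (s : ℝ) : ℂ := s / (1 - (1 - s) * z)

theorem arc_denom_norm_gt {z : ℂ} (hz : z ∈ disc) {s : ℝ} (h1 : s < 1) :
    s < ‖1 - (1 - (s : ℂ)) * z‖ := by
  have h2 : 1 - ‖(1 - (s : ℂ)) * z‖ ≤ ‖1 - (1 - (s : ℂ)) * z‖ := by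
    simpa using norm_sub_norm_le (1 : ℂ) ((1 - (s : ℂ)) * z)
  have h3 : ‖(1 - (s : ℂ)) * z‖ = (1 - s) * ‖z‖ := by
    rw [norm_mul]
    congr 1
    have : (1 - (s : ℂ)) = ((1 - s : ℝ) : ℂ) := by push_cast; ring
    rw [this, Complex.norm_real, Real.norm_of_nonneg (by linarith)]
  nlinarith [mem_disc.1 hz]

theorem arc_denom_ne_zero {z : ℂ} (hz : z ∈ disc) {s : ℝ} (h1 : s ≤ 1) (h0 : 0 ≤ s) :
    1 - (1 - (s : ℂ)) * z ≠ 0 := by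
  rcases h1.lt_or_eq with h | rfl
  · exact norm_pos_iff.1 (h0.trans_lt (arc_denom_norm_gt hz h))
  · simp

theorem arc_mem_disc {z : ℂ} (hz : z ∈ disc) {s : ℝ} (h1 : s < 1) (h0 : 0 ≤ s) :
    arc z s ∈ disc := by
  have h := arc_denom_norm_gt hz h1
  rw [mem_disc, arc, norm_div, Complex.norm_real, Real.norm_of_nonneg h0, div_lt_one (by linarith)]
  exact h

theorem hasDerivAt_arc {z : ℂ} (hz : z ∈ disc) {s : ℝ} (h1 : s ≤ 1) (h0 : 0 ≤ s) :
    HasDerivAt (arc z) ((1 - z) / (1 - (1 - s) * z) ^ 2) s := by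
  have h := arc_denom_ne_zero hz h1 h0
  have hs : HasDerivAt (fun s : ℝ => (s : ℂ)) 1 s := Complex.ofRealCLM.hasDerivAt
  refine (hs.div (((hs.const_sub 1).mul_const z).const_sub 1) h).congr_deriv ?_
  ring

/-- Along the arc γ one has 1 - γ z = (1 - z) / (1 - (1 - s) z), so γ' / (1 - γ z)² is the constant
1 / (1 - z) and the integrand becomes γ f(γ) / (1 - z). As f is given only inside the disc, both
paths stop at parameter b < 1, with b → 1 at the end. -/
theorem norm_integral_deriv_hilbert_le {f : ℂ → ℂ} (hf : DifferentiableOn ℂ f disc) {M : ℝ}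
    (hM0 : 0 ≤ M) (hM : ∀ z ∈ disc, ‖f z‖ ≤ M) {z : ℂ} (hz : z ∈ disc) :
    ‖∫ t : ℝ in Set.Ioo 0 1, t * f t / (1 - t * z) ^ 2‖ ≤ M / ‖1 - z‖ := by
  have hz1 := mem_disc.1 hz
  have hz2 : 0 < 1 - ‖z‖ := by linarith
  have h1z := norm_one_sub_pos hz
  let g : ℂ → ℂ := fun ζ => ζ * f ζ / (1 - ζ * z) ^ 2
  have hden : ∀ ζ ∈ disc, 1 - ‖z‖ ≤ ‖1 - ζ * z‖ := fun ζ hζ => by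
    have h2 : 1 - ‖ζ * z‖ ≤ ‖1 - ζ * z‖ := by simpa using norm_sub_norm_le (1 : ℂ) (ζ * z)
    have h3 : ‖ζ * z‖ ≤ ‖z‖ := by
      rw [norm_mul]
      exact mul_le_of_le_one_left (norm_nonneg z) (mem_disc.1 hζ).le
    linarith
  have hg : DifferentiableOn ℂ g disc :=
    (differentiableOn_id.mul hf).div (by fun_prop) fun ζ hζ =>
      pow_ne_zero 2 (norm_pos_iff.1 (hz2.trans_le (hden ζ hζ)))
  let C := M / (1 - ‖z‖) ^ 2
  have hC0 : 0 ≤ C := by positivity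
  have hgC : ∀ ζ ∈ disc, ‖g ζ‖ ≤ C := fun ζ hζ => by
    have h1 := hM ζ hζ
    have h2 := (mem_disc.1 hζ).le
    have h3 := hden ζ hζ
    simp only [g, C, norm_div, norm_mul, norm_pow]
    gcongr
    exact (mul_le_of_le_one_left (norm_nonneg _) h2).trans h1
  -- A primitive replaces Cauchy's theorem; it is Lipschitz because `g` is bounded for fixed z.
  obtain ⟨G, hG⟩ : ∃ G : ℂ → ℂ, ∀ ζ ∈ disc, HasDerivAt G (g ζ) ζ := hg.isExactOn_ball
  have hLip : ∀ ζ ∈ disc, ∀ ξ ∈ disc, ‖G ζ - G ξ‖ ≤ C * ‖ζ - ξ‖ := fun ζ hζ ξ hξ =>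
    (convex_ball (0 : ℂ) 1).norm_image_sub_le_of_norm_hasDerivWithin_le
      (fun w hw => (hG w hw).hasDerivWithinAt) hgC hξ hζ
  have hgi : IntegrableOn (fun t : ℝ => g t) (Set.Ioo 0 1) := by
    refine Integrable.of_bound (C := C) (aestronglyMeasurable_comp_ofReal hg) ?_
    filter_upwards [ae_restrict_mem measurableSet_Ioo] with t ht using hgC _ (ofReal_mem_disc ht)
  have hgi' : IntervalIntegrable (fun t : ℝ => g t) volume 0 1 := by
    rwa [intervalIntegrable_iff_integrableOn_Ioo_of_le zero_le_one]
  have harc : ∀ b ∈ Set.Ioo (0 : ℝ) 1, ‖G (arc z b) - G 0‖ ≤ M / ‖1 - z‖ := by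
    intro b hb
    have hd : ∀ s ∈ Set.Icc 0 b, HasDerivAt (fun s => G (arc z s))
        (arc z s * f (arc z s) / (1 - z)) s := by
      intro s hs
      have hs1 : s < 1 := hs.2.trans_lt hb.2
      have hne := arc_denom_ne_zero hz hs1.le hs.1
      have h1zne : 1 - z ≠ 0 := norm_pos_iff.1 h1z
      refine ((hG _ (arc_mem_disc hz hs1 hs.1)).comp_of_eq s
        (hasDerivAt_arc hz hs1.le hs.1) rfl).congr_deriv ?_
      have e : 1 - arc z s * z = (1 - z) / (1 - (1 - s) * z) := by
        rw [arc, eq_div_iff hne, sub_mul, div_mul_eq_mul_div, div_mul_cancel₀ _ hne]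
        ring
      simp only [g, e]
      generalize 1 - (1 - (s : ℂ)) * z = D at *
      field_simp
    have := norm_image_sub_le_of_norm_deriv_le_segment' (C := M / ‖1 - z‖)
      (fun s hs => (hd s hs).hasDerivWithinAt) (fun s hs => ?_) b (Set.right_mem_Icc.2 hb.1.le)
    · have h0 : arc z 0 = 0 := by simp [arc]
      rw [h0] at this
      refine this.trans ?_
      rw [sub_zero]
      exact mul_le_of_le_one_right (by positivity) hb.2.le
    · have hmem := arc_mem_disc hz (hs.2.trans hb.2) hs.1
      rw [norm_div, norm_mul]
      gcongr
      exact (mul_le_of_le_one_left (norm_nonneg _) (mem_disc.1 hmem).le).trans (hM _ hmem)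
  -- Three pieces: the tail over [b, 1], the gap between b and the arc point, and the arc. The first
  -- two vanish as b → 1.
  have hbound : ∀ b ∈ Set.Ioo (0 : ℝ) 1, ‖∫ t : ℝ in Set.Ioo 0 1, g t‖ ≤
      C * (1 - b) + C * ‖(b : ℂ) - arc z b‖ + M / ‖1 - z‖ := by
    intro b hb
    have hbI : b ∈ Set.uIcc (0 : ℝ) 1 := by
      rw [Set.uIcc_of_le zero_le_one]; exact Set.Ioo_subset_Icc_self hb
    have i1 := hgi'.mono_set (Set.uIcc_subset_uIcc Set.left_mem_uIcc hbI)
    have i2 := hgi'.mono_set (Set.uIcc_subset_uIcc hbI Set.right_mem_uIcc)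
    have e1 : ∫ t in (0 : ℝ)..b, g t = G b - G 0 := by
      rw [intervalIntegral.integral_eq_sub_of_hasDerivAt (f := fun t : ℝ => G t) _ i1]
      · simp
      · intro t ht
        rw [Set.uIcc_of_le hb.1.le] at ht
        refine (hG t ?_).comp_ofReal
        simpa [mem_disc, abs_of_nonneg ht.1] using ht.2.trans_lt hb.2
    have e2 : ‖∫ t in b..(1 : ℝ), g t‖ ≤ C * (1 - b) := by
      rw [intervalIntegral.integral_of_le hb.2.le, integral_Ioc_eq_integral_Ioo]
      refine (norm_setIntegral_le_of_norm_le_const (C := C) (by simp)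
        fun t ht => hgC _ (ofReal_mem_disc ⟨hb.1.trans ht.1, ht.2⟩)).trans (le_of_eq ?_)
      simp [hb.2.le]
    have e3 := hLip _ (ofReal_mem_disc hb) _ (arc_mem_disc hz hb.2 hb.1.le)
    have e4 := harc b hb
    have e5 : ∫ t : ℝ in Set.Ioo 0 1, g t =
        (∫ t in b..(1 : ℝ), g t) + (G b - G (arc z b)) + (G (arc z b) - G 0) := by
      rw [← integral_Ioc_eq_integral_Ioo, ← intervalIntegral.integral_of_le zero_le_one,
        ← intervalIntegral.integral_add_adjacent_intervals i1 i2, e1]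
      ring
    rw [e5]
    exact (norm_add₃_le).trans (by gcongr)
  have hlim : Filter.Tendsto
      (fun b : ℝ => C * (1 - b) + C * ‖(b : ℂ) - arc z b‖ + M / ‖1 - z‖)
      (nhdsWithin 1 (Set.Iio 1)) (nhds (M / ‖1 - z‖)) := by
    have hc : ContinuousAt
        (fun b : ℝ => C * (1 - b) + C * ‖(b : ℂ) - arc z b‖ + M / ‖1 - z‖) 1 := by
      have := (hasDerivAt_arc hz le_rfl zero_le_one).continuousAt
      fun_prop
    have := hc.tendsto.mono_left (nhdsWithin_le_nhds (s := Set.Iio 1))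
    simpa [arc] using this
  refine ge_of_tendsto hlim ?_
  filter_upwards [Ioo_mem_nhdsLT (zero_lt_one' ℝ)] with b hb using hbound b hb

theorem norm_deriv_hilbertOp_le {f : ℂ → ℂ} (hf : DifferentiableOn ℂ f disc) {M : ℝ}
    (hM0 : 0 ≤ M) (hM : ∀ z ∈ disc, ‖f z‖ ≤ M) {z : ℂ} (hz : z ∈ disc) :
    ‖deriv (hilbertOp f) z‖ ≤ M / ‖1 - z‖ := by
  rw [(hasDerivAt_hilbertOp hf hM0 hM hz).deriv]
  exact norm_integral_deriv_hilbert_le hf hM0 hM hz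

theorem norm_hilbertOp_zero_le {f : ℂ → ℂ} (hf : DifferentiableOn ℂ f disc) {M : ℝ}
    (hM0 : 0 ≤ M) (hM : ∀ z ∈ disc, ‖f z‖ ≤ M) : ‖hilbertOp f 0‖ ≤ M := by
  rw [hilbertOp_eq_integral hf hM0 hM (by simp [mem_disc])]
  refine (norm_setIntegral_le_of_norm_le_const (C := M) (by simp) fun t ht => ?_).trans
    (le_of_eq ?_)
  · simpa using hM _ (ofReal_mem_disc ht)
  · simp

theorem exists_norm_le_of_mem_HInf {f : ℂ → ℂ} (hf : f ∈ HInf) :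
    ∃ M : ℝ, 0 ≤ M ∧ ENNReal.ofReal M = hInfNorm f ∧ ∀ z ∈ disc, ‖f z‖ ≤ M := by
  refine ⟨(hInfNorm f).toReal, ENNReal.toReal_nonneg, ENNReal.ofReal_toReal hf.2.ne,
    fun z hz => ?_⟩
  have h : ‖f z‖ₑ ≤ hInfNorm f := le_iSup₂ (f := fun z (_ : z ∈ disc) => ‖f z‖ₑ) z hz
  simpa using ENNReal.toReal_mono hf.2.ne h

theorem mNorm_hilbertOp_le (μ : Measure ℂ) {f : ℂ → ℂ} (hf : f ∈ HInf) :
    mNorm μ (hilbertOp f) ≤ hInfNorm f * (1 + mNorm μ logOneSub) := by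
  obtain ⟨M, hM0, hMe, hM⟩ := exists_norm_le_of_mem_HInf hf
  rw [mNorm_eq, mNorm_eq, ← hMe]
  have h0 : ‖logOneSub 0‖ₑ = 0 := by simp [logOneSub]
  rw [h0, zero_add, mul_add, mul_one]
  refine add_le_add ?_ (mSeminorm_le_mul μ ENNReal.ofReal_ne_top fun z hz => ?_)
  · rw [← ofReal_norm]
    exact ENNReal.ofReal_le_ofReal (norm_hilbertOp_zero_le hf.1 hM0 hM)
  · rw [enorm_deriv_logOneSub hz, ← ofReal_norm, ← ENNReal.ofReal_mul hM0]
    refine ENNReal.ofReal_le_ofReal ?_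
    rw [mul_one_div]
    exact norm_deriv_hilbertOp_le hf.1 hM0 hM hz

theorem hilbertOp_mem_Hol {f : ℂ → ℂ} (hf : f ∈ HInf) : hilbertOp f ∈ Hol := by
  obtain ⟨M, hM0, -, hM⟩ := exists_norm_le_of_mem_HInf hf
  exact fun z hz =>
    (hasDerivAt_hilbertOp hf.1 hM0 hM hz).differentiableAt.differentiableWithinAt

/-! ### The lower bound: the constant function 1 -/

theorem abs_det_complex_smul_one (a : ℂ) :
    |(a • (1 : ℂ →L[ℝ] ℂ)).det| = ‖a‖ ^ 2 := by
  have : (a • (1 : ℂ →L[ℝ] ℂ)).det = ‖a‖ ^ 2 := by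
    rw [ContinuousLinearMap.det, ← LinearMap.det_toMatrix Complex.basisOneI, Matrix.det_fin_two,
      ← Complex.normSq_eq_norm_sq, Complex.normSq_apply]
    simp [LinearMap.toMatrix_apply]
  rw [this, abs_of_nonneg (sq_nonneg _)]

theorem lintegral_areaMeasure_comp_of_bijOn {σ σ' : ℂ → ℂ}
    (hσ : ∀ z ∈ disc, HasDerivAt σ (σ' z) z) (hb : Set.BijOn σ disc disc) (g : ℂ → ℝ≥0∞) :
    ∫⁻ z, g z ∂areaMeasure = ∫⁻ w, ENNReal.ofReal (‖σ' w‖ ^ 2) * g (σ w) ∂areaMeasure := by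
  have h := lintegral_image_eq_lintegral_abs_det_fderiv_mul volume measurableSet_disc
    (fun z hz => (hσ z hz).complexToReal_fderiv.hasFDerivWithinAt) hb.injOn g
  rw [hb.image_eq] at h
  simp only [abs_det_complex_smul_one] at h
  rw [areaMeasure, lintegral_smul_measure, lintegral_smul_measure, h]

theorem tendsto_mul_log_zero :
    Filter.Tendsto (fun x : ℂ => x * Complex.log x) (nhds 0) (nhds 0) := by
  have h : Filter.Tendsto (fun x : ℂ => |‖x‖ * Real.log ‖x‖| + ‖x‖ * Real.pi) (nhds 0)
      (nhds 0) := by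
    have : Continuous fun x : ℂ => |‖x‖ * Real.log ‖x‖| + ‖x‖ * Real.pi :=
      (Real.continuous_mul_log.comp continuous_norm).abs.add (by fun_prop)
    simpa using this.tendsto 0
  refine squeeze_zero_norm (fun x => ?_) h
  rw [norm_mul, abs_mul, abs_of_nonneg (norm_nonneg x), ← mul_add]
  gcongr
  refine (Complex.norm_le_abs_re_add_abs_im _).trans ?_
  rw [Complex.log_re, Complex.log_im]
  gcongr
  exact Complex.abs_arg_le_pi x

theorem hilbertCoeff_one (n : ℕ) : hilbertCoeff (fun _ => 1) n = 1 / ((n : ℂ) + 1) := by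
  rw [hilbertCoeff_eq_integral (M := 1) (differentiableOn_const 1) zero_le_one (by simp),
    ← integral_Ioc_eq_integral_Ioo, ← intervalIntegral.integral_of_le zero_le_one]
  have := integral_pow (a := 0) (b := 1) n
  have := congrArg (fun x : ℝ => (x : ℂ)) this
  rw [← intervalIntegral.integral_ofReal] at this
  simpa using this

theorem mul_hilbertOp_one {z : ℂ} (hz : z ∈ disc) :
    z * hilbertOp (fun _ => 1) z = -logOneSub z := by
  have h1 := (hasSum_hilbertCoeff (M := 1) (differentiableOn_const 1) zero_le_one (by simp)
    hz).summable.hasSum.mul_left z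
  have h2 := (hasSum_nat_add_iff' 1).2 (Complex.hasSum_taylorSeries_neg_log (mem_disc.1 hz))
  simp only [Finset.range_one, Finset.sum_singleton, Nat.cast_zero, div_zero, sub_zero] at h2
  refine h1.unique (h2.congr_fun fun n => ?_)
  rw [hilbertCoeff_one]
  push_cast
  ring

theorem one_sub_mul_deriv_hilbertOp_one {z : ℂ} (hz : z ∈ disc) (h0 : z ≠ 0) :
    (1 - z) * deriv (hilbertOp fun _ => 1) z =
      (1 + (1 - z) * Complex.log (1 - z) / z) / z := by
  have hd := hasDerivAt_hilbertOp (f := fun _ => 1) (M := 1) (differentiableOn_const 1)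
    zero_le_one (by simp) hz
  have h1 := (hasDerivAt_id z).mul hd
  have h2 : HasDerivAt (id * hilbertOp fun _ => 1) (-(-1 / (1 - z))) z := by
    refine (hasDerivAt_logOneSub hz).neg.congr_of_eventuallyEq ?_
    filter_upwards [isOpen_disc.mem_nhds hz] with w hw using mul_hilbertOp_one hw
  have h3 := h1.unique h2
  rw [hd.deriv]
  generalize (∫ t : ℝ in Set.Ioo 0 1, (t : ℂ) * 1 / (1 - t * z) ^ 2) = D at *
  have h4 := mul_hilbertOp_one hz
  rw [logOneSub] at h4
  generalize hilbertOp (fun _ => 1) z = H at *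
  have hne : 1 - z ≠ 0 := norm_pos_iff.1 (norm_one_sub_pos hz)
  have h5 : Complex.log (1 - z) = -(z * H) := by rw [h4, neg_neg]
  have h6 : H + z * D = 1 / (1 - z) := by
    simp only [id, one_mul] at h3
    rw [h3]; ring
  rw [eq_div_iff hne] at h6
  rw [h5]
  field_simp
  linear_combination h6

/-- Near 1, H(1) has the same leading singularity as -log(1 - z), because (1 - z) log(1 - z) → 0. -/
theorem tendsto_one_sub_mul_deriv_hilbertOp_one :
    Filter.Tendsto (fun z => (1 - z) * deriv (hilbertOp fun _ => 1) z) (nhdsWithin 1 disc)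
      (nhds 1) := by
  have h1 : Filter.Tendsto (fun z : ℂ => (1 - z) * Complex.log (1 - z)) (nhds 1) (nhds 0) := by
    refine tendsto_mul_log_zero.comp ?_
    simpa using (by fun_prop : Continuous fun z : ℂ => 1 - z).tendsto 1
  have hid : Filter.Tendsto (fun z : ℂ => z) (nhds 1) (nhds 1) := Filter.tendsto_id
  have h2 := ((h1.div hid one_ne_zero).const_add 1).div hid one_ne_zero
  simp only [add_zero, div_one] at h2
  refine (h2.mono_left nhdsWithin_le_nhds).congr' ?_
  filter_upwards [self_mem_nhdsWithin,
    mem_nhdsWithin_of_mem_nhds (isOpen_ne.mem_nhds (one_ne_zero' ℂ))] with z hz h0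
  exact (one_sub_mul_deriv_hilbertOp_one hz h0).symm

theorem hasDerivAt_mobius {a z : ℂ} (ha : a ∈ disc) (hz : z ∈ disc) :
    HasDerivAt (mobius a)
      (-(1 - (starRingEnd ℂ) a * a) / (1 - (starRingEnd ℂ) a * z) ^ 2) z := by
  have h := one_sub_conj_mul_ne_zero (mem_disc.1 ha).le (mem_disc.1 hz)
  refine (((hasDerivAt_id z).const_sub a).div
    (((hasDerivAt_id z).const_mul ((starRingEnd ℂ) a)).const_sub 1) h).congr_deriv ?_
  simp only [id]
  ring

theorem aemeasurable_potential_comp {p : ℝ} (hp0 : 0 < p) (hp1 : p < 1) {φ : ℂ → ℂ}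
    (hφ : φ ∈ discAut) : AEMeasurable (fun w => potential (muP p) (φ w)) areaMeasure := by
  have hc : ContinuousOn φ disc := DifferentiableOn.continuousOn hφ.1
  have hm : AEMeasurable φ areaMeasure :=
    (hc.aemeasurable measurableSet_disc).smul_measure _
  have : AEMeasurable (fun w => ENNReal.ofReal (4 * (1 - ‖φ w‖ ^ 2) ^ p)) areaMeasure := by
    fun_prop
  refine this.congr ?_
  filter_upwards [areaMeasure_ae_mem_disc] with z hz
  exact (potential_muP hp0 hp1 (mem_disc.1 (hφ.2.mapsTo hz))).symm

/-- The hyperbolic parameters `1 - 1 / (n + 2)`. -/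
noncomputable def hyp (n : ℕ) : ℝ := 1 - 1 / ((n : ℝ) + 2)

theorem hyp_mem (n : ℕ) : hyp n ∈ Set.Ioo (0 : ℝ) 1 := by
  have h : (0 : ℝ) < n + 2 := by positivity
  have h1 : 1 / ((n : ℝ) + 2) < 1 := by rw [div_lt_one h]; linarith [n.cast_nonneg (α := ℝ)]
  have h2 : 0 < 1 / ((n : ℝ) + 2) := by positivity
  exact ⟨by rw [hyp]; linarith, by rw [hyp]; linarith⟩

theorem tendsto_hyp : Filter.Tendsto (fun n => (hyp n : ℂ)) Filter.atTop (nhds 1) := by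
  have h := (Filter.tendsto_add_atTop_iff_nat (f := fun n : ℕ => 1 / ((n : ℝ) + 1)) 1).2
    tendsto_one_div_add_atTop_nhds_zero_nat
  have h2 : Filter.Tendsto hyp Filter.atTop (nhds (1 - 0)) := by
    refine (h.const_sub 1).congr fun n => ?_
    rw [hyp]; push_cast; ring
  rw [sub_zero] at h2
  exact_mod_cast (Complex.continuous_ofReal.tendsto 1).comp h2

theorem tendsto_mobius_hyp {w : ℂ} (hw : w ∈ disc) :
    Filter.Tendsto (fun n => mobius (hyp n) w) Filter.atTop (nhdsWithin 1 disc) := by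
  refine tendsto_nhdsWithin_iff.2 ⟨?_, Filter.Eventually.of_forall fun n =>
    mobius_mem_disc (ofReal_mem_disc (hyp_mem n)) hw⟩
  have hne : 1 - w ≠ 0 := norm_pos_iff.1 (norm_one_sub_pos hw)
  have h := (tendsto_hyp.sub_const w).div ((tendsto_hyp.mul_const w).const_sub 1) (by simpa)
  rw [one_mul, div_self hne] at h
  refine h.congr fun n => ?_
  simp [mobius]

/-- The complex derivative of `mobius a`. -/
noncomputable def mobiusDeriv (a z : ℂ) : ℂ :=
  -(1 - (starRingEnd ℂ) a * a) / (1 - (starRingEnd ℂ) a * z) ^ 2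

/-- Since 1 - σ_c(w) = (1 - c)(1 + w) / (1 - c w), the factor 1 - c of σ_c' cancels, leaving (1 + c)
/ ((1 + w)(1 - c w)) times a quantity tending to 1. -/
theorem tendsto_deriv_hilbertOp_one_comp_mobius {w : ℂ} (hw : w ∈ disc) :
    Filter.Tendsto (fun n => ‖mobiusDeriv (hyp n) w‖ *
      ‖deriv (hilbertOp fun _ => 1) (mobius (hyp n) w)‖) Filter.atTop
      (nhds (2 / (‖1 + w‖ * ‖1 - w‖))) := by
  have hne : 1 - w ≠ 0 := norm_pos_iff.1 (norm_one_sub_pos hw)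
  have hne' : 1 + w ≠ 0 := by
    have : -w ∈ disc := by simpa [mem_disc] using hw
    simpa using norm_pos_iff.1 (norm_one_sub_pos this)
  have h1 := tendsto_one_sub_mul_deriv_hilbertOp_one.comp (tendsto_mobius_hyp hw)
  have h2 := (tendsto_hyp.const_add 1).div
    ((((tendsto_hyp.mul_const w).const_sub 1).const_mul (1 + w)))
    (by simpa using mul_ne_zero hne' hne)
  have h3 := (h2.mul h1).norm
  have e : ‖(1 + 1) / ((1 + w) * (1 - 1 * w)) * 1‖ = 2 / (‖1 + w‖ * ‖1 - w‖) := by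
    rw [mul_one, one_mul, norm_div, norm_mul]; norm_num
  rw [e] at h3
  refine h3.congr fun n => ?_
  have hc := hyp_mem n
  have hcd := ofReal_mem_disc hc
  have hk := one_sub_conj_mul_ne_zero (mem_disc.1 hcd).le (mem_disc.1 hw)
  rw [Complex.conj_ofReal] at hk
  have hc1 : 1 - (hyp n : ℂ) ≠ 0 := norm_pos_iff.1 (norm_one_sub_pos hcd)
  have e1 : 1 - mobius (hyp n) w = (1 - hyp n) * (1 + w) / (1 - hyp n * w) := by
    rw [mobius, Complex.conj_ofReal, eq_div_iff hk, sub_mul, div_mul_cancel₀ _ hk]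
    ring
  simp only [Function.comp_apply, Pi.div_apply]
  rw [e1, ← norm_mul, ← norm_neg, mobiusDeriv, Complex.conj_ofReal]
  congr 1
  generalize deriv (hilbertOp fun _ => 1) (mobius (hyp n) w) = D
  generalize (hyp n : ℂ) = c at *
  have hk' : 1 - w * c ≠ 0 := by rwa [mul_comm]
  field_simp
  ring

/-- By Möbius invariance the integrals for H(1) ∘ σ_c never exceed the squared seminorm of H(1);
Fatou's lemma passes this to the limit c → 1. -/
theorem mSeminorm_logOneSub_le {p : ℝ} (hp0 : 0 < p) (hp1 : p < 1) :
    mSeminorm (muP p) (deriv logOneSub) ≤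
      mSeminorm (muP p) (deriv (hilbertOp fun _ => 1)) := by
  set S := mSeminorm (muP p) (deriv (hilbertOp fun _ => 1))
  refine iSup₂_le fun φ hφ => ?_
  let D := deriv (hilbertOp fun _ => 1)
  let U := fun w => potential (muP p) (φ w)
  let F : ℕ → ℂ → ℝ≥0∞ := fun n w =>
    ENNReal.ofReal ((‖mobiusDeriv (hyp n) w‖ * ‖D (mobius (hyp n) w)‖) ^ 2) * U w
  have hF : ∀ n, AEMeasurable (F n) areaMeasure := fun n => by
    have h1 : Measurable (mobius (hyp n)) := by unfold mobius; fun_prop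
    have h2 : Measurable (mobiusDeriv (hyp n)) := by unfold mobiusDeriv; fun_prop
    have h3 : Measurable D := measurable_deriv _
    have h4 := h3.comp h1
    exact ((h2.norm.mul h4.norm).pow_const 2).ennreal_ofReal.aemeasurable.mul
      (aemeasurable_potential_comp hp0 hp1 hφ)
  have hFS : ∀ n, ∫⁻ w, F n w ∂areaMeasure ≤ S ^ 2 := fun n => by
    have hc := ofReal_mem_disc (hyp_mem n)
    have hσ := mobius_mem_discAut hc
    -- Testing with φ ∘ σ and substituting σ restores φ, since σ is an involution.
    have h1 : (∫⁻ w, ‖D w‖ₑ ^ 2 * potential (muP p) ((φ ∘ mobius (hyp n)) w) ∂areaMeasure) ^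
        (1 / 2 : ℝ) ≤ S :=
      le_iSup₂ (f := fun φ (_ : φ ∈ discAut) => (∫⁻ w, ‖D w‖ₑ ^ 2 * potential (muP p) (φ w)
        ∂areaMeasure) ^ (1 / 2 : ℝ)) _ (discAut_comp hφ hσ)
    have h2 := ENNReal.rpow_le_rpow h1 (by norm_num : (0 : ℝ) ≤ 2)
    rw [← ENNReal.rpow_mul, ← ENNReal.rpow_natCast] at *
    norm_num at h2 ⊢
    rw [lintegral_areaMeasure_comp_of_bijOn (fun z hz => hasDerivAt_mobius hc hz) hσ.2] at h2
    refine le_trans (le_of_eq ?_) h2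
    refine lintegral_congr_ae ?_
    filter_upwards [areaMeasure_ae_mem_disc] with w hw
    simp only [F, U, mobius_mobius hc hw]
    rw [mul_pow, ENNReal.ofReal_mul (by positivity), ENNReal.ofReal_pow (norm_nonneg (D _)),
      ofReal_norm, mul_assoc, mobiusDeriv]
  have hlim : ∫⁻ w, Filter.liminf (fun n => F n w) Filter.atTop ∂areaMeasure ≤ S ^ 2 := by
    refine (lintegral_liminf_le' hF).trans ?_
    refine (Filter.liminf_le_liminf (Filter.Eventually.of_forall hFS)).trans ?_
    simp
  have hmain : ∫⁻ w, ‖deriv logOneSub w‖ₑ ^ 2 * potential (muP p) (φ w) ∂areaMeasure ≤ S ^ 2 := by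
    refine le_trans (lintegral_mono_ae ?_) hlim
    filter_upwards [areaMeasure_ae_mem_disc] with w hw
    have h1w := norm_one_sub_pos hw
    have h1w' : 0 < ‖1 + w‖ := by
      have : -w ∈ disc := by simpa [mem_disc] using hw
      simpa using norm_one_sub_pos this
    -- The limit is nonzero, so multiplication by `U w` is continuous there without knowing `U w`
    -- finite.
    have ht := ENNReal.Tendsto.mul_const (b := U w) (ENNReal.tendsto_ofReal
      ((tendsto_deriv_hilbertOp_one_comp_mobius hw).pow 2))
      (Or.inl (by simp only [ne_eq, ENNReal.ofReal_eq_zero, not_le]; positivity))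
    rw [ht.liminf_eq, enorm_deriv_logOneSub hw, ← ENNReal.ofReal_pow (by positivity)]
    refine mul_le_mul_left (ENNReal.ofReal_le_ofReal ?_) _
    have h2 : ‖1 + w‖ ≤ 2 := by
      have := norm_add_le 1 w
      rw [norm_one] at this
      linarith [mem_disc.1 hw]
    gcongr ?_ ^ 2
    rw [div_le_div_iff₀ h1w (by positivity)]
    nlinarith
  calc _ ≤ (S ^ 2) ^ (1 / 2 : ℝ) := ENNReal.rpow_le_rpow hmain (by norm_num)
    _ = S := by rw [← ENNReal.rpow_natCast, ← ENNReal.rpow_mul]; norm_num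

theorem hilbertOp_one_zero : hilbertOp (fun _ => 1) 0 = 1 := by
  rw [hilbertOp_eq_integral (M := 1) (differentiableOn_const 1) zero_le_one (by simp)
    (by simp [mem_disc])]
  simp

theorem opNormHInf_hilbertOp {p : ℝ} (hp0 : 0 < p) (hp1 : p < 1) :
    opNormHInf hilbertOp (mNorm (muP p)) = 1 + mNorm (muP p) logOneSub := by
  refine le_antisymm (iSup₂_le fun f hf => ?_) ?_
  · refine (mNorm_hilbertOp_le (muP p) hf.1).trans ?_
    exact mul_le_of_le_one_left' hf.2
  · have h1 : hInfNorm (fun _ => 1) ≤ 1 := iSup₂_le fun z _ => by simp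
    have hmem : (fun _ : ℂ => (1 : ℂ)) ∈ {f | f ∈ HInf ∧ hInfNorm f ≤ 1} :=
      ⟨⟨differentiableOn_const 1, h1.trans_lt ENNReal.one_lt_top⟩, h1⟩
    refine le_trans ?_ (le_iSup₂ (f := fun f (_ : f ∈ {f | f ∈ HInf ∧ hInfNorm f ≤ 1}) =>
      mNorm (muP p) (hilbertOp f)) _ hmem)
    have h0 : logOneSub 0 = 0 := by simp [logOneSub]
    rw [mNorm_eq, mNorm_eq, hilbertOp_one_zero, h0, enorm_zero, zero_add, enorm_one]
    exact add_le_add le_rfl (mSeminorm_logOneSub_le hp0 hp1)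

end HilbertQp

theorem corollary6p4 (p : ℝ) (hp0 : 0 < p) (hp1 : p < 1) :
    HilbertQp.QSpace p = HilbertQp.MSpace (HilbertQp.muP p) ∧
    HilbertQp.logOneSub ∈ HilbertQp.MSpace (HilbertQp.muP p) ∧
    (∀ f ∈ HilbertQp.HInf,
      (∀ n : ℕ, Summable (HilbertQp.hilbertTerm f n)) ∧
      (∀ z ∈ HilbertQp.disc, Summable fun n : ℕ => HilbertQp.hilbertCoeff f n * z ^ n) ∧
      HilbertQp.hilbertOp f ∈ HilbertQp.QSpace p) ∧
    HilbertQp.opNormHInf HilbertQp.hilbertOp (HilbertQp.mNorm (HilbertQp.muP p)) =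
      1 + HilbertQp.mNorm (HilbertQp.muP p) HilbertQp.logOneSub := by
  have hQM := HilbertQp.QSpace_eq_MSpace hp0 hp1
  have hlog : HilbertQp.logOneSub ∈ HilbertQp.MSpace (HilbertQp.muP p) :=
    hQM ▸ HilbertQp.logOneSub_mem_QSpace hp0
  refine ⟨hQM, hlog, fun f hf => ?_, HilbertQp.opNormHInf_hilbertOp hp0 hp1⟩
  obtain ⟨M, hM0, -, hM⟩ := HilbertQp.exists_norm_le_of_mem_HInf hf
  refine ⟨fun n => (HilbertQp.summable_norm_hilbertTerm hf.1 hM0 hM n).of_norm,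
    fun z hz => (HilbertQp.hasSum_hilbertCoeff hf.1 hM0 hM hz).summable, ?_⟩
  rw [hQM]
  refine ⟨HilbertQp.hilbertOp_mem_Hol hf,
    (HilbertQp.mNorm_hilbertOp_le _ hf).trans_lt (ENNReal.mul_lt_top hf.2 ?_)⟩
  exact ENNReal.add_lt_top.2 ⟨ENNReal.one_lt_top, hlog.2⟩
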